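/- All matroids are finite. For a set $E$ let $\mathrm{Sym}_i(E)$ be the set of unordered $i$-tuples (multisets of size $i$) of elements of $E$; tuples are multiplied by concatenation, and for $\alpha\in \mathrm{Sym}_{d-i}(E)$ let $\mathrm{Sym}_d(E)|_\alpha=\{\alpha x : x\in \mathrm{Sym}_i(E)\}$. For $d\ge 1$, a $d$-th symmetric power of a matroid $M$ on $E$ is a sequence of matroids $(M_1,\dots,M_d)$ with $M_1=M$, such that for all $1\le i\le d$ the ground set of $M_i$ is $\mathrm{Sym}_i(E)$ and, for every $\alpha\in\mathrm{Sym}_{d-i}(E)$: if $\alpha$ is not divisible by a loop of $M$, then $x\mapsto \alpha x$ is an isomorphism from $M_i$ onto the restriction of $M_d$ to $\mathrm{Sym}_d(E)|_\alpha$, and otherwise that restriction has rank $0$; and such that $\mathrm{rk}(M_d)=\binom{\mathrm{rk}(M)+d-1}{d}$. A forbidden minor for the class of matroids with a $d$-th symmetric power is a matroid that has no $d$-th symmetric power although all its proper minors have one. For $r\ge 4$ let $M(r)$ be Lindström's matroid of rank $r$ on the disjoint union $A\cup B\cup C\cup D$ of four sets of size $r-2$, whose cyclic flats other than $\emptyset$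 and the ground set are $A\cup B$, $A\cup C$, $A\cup D$, $B\cup C$, $B\cup D$, each of rank $r-1$ (equivalently: a set is independent if and only if it has at most $r$ elements and meets each of these five sets in at most $r-1$ elements). **Theorem.** 1. For every $d\ge 1$, the class of matroids that have a $d$-th symmetric power is closed under taking minors. 2. For every $d\ge 2$, this class has infinitely many pairwise non-isomorphic forbidden minors. 3. For every $r\ge 4$, the matroid $M(r)\oplus U_{2,3}$ has no second symmetric power. 4. For every $d\ge 2$ and every $r\ge 4$, the matroid $M(r)\oplus U_{2,3}$ has a minor that is a forbidden minor for the class of matroids with a $d$-th symmetric power and that is not isomorphic to a minor of $M(s)\oplus U_{2,3}$ for any $s\ge 4$ with $s\ne r$. -/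

import Mathlib

open Set

namespace Matroid

/-- `Sym_d(E)`, the set of unordered `d`-tuples of elements of `E` (multisets of size `d`);
the product `αβ` of two tuples is the sum `α + β` of multisets. -/
def symSet {α : Type*} (E : Set α) (d : ℕ) : Set (Multiset α) :=
  {s | Multiset.card s = d ∧ ∀ e ∈ s, e ∈ E}

/-- `Sym_d(E)|_a`, the elements of `Sym_d(E)` that are divisible by `a`. -/
def symSetDvd {α : Type*} (E : Set α) (d : ℕ) (a : Multiset α) : Set (Multiset α) :=
  {s ∈ symSet E d | ∃ x, s = a + x}

/-- `(V 1, …, V d)` is a `d`-th symmetric quasi power of `M` (other values of `V` play no role).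
An element `e` of the ground set of `M` is identified with the one-element tuple `{e}`. -/
structure IsSymmetricQuasiPower {α : Type*} (M : Matroid α) (d : ℕ)
    (V : ℕ → Matroid (Multiset α)) : Prop where
  one : V 1 = M.map (fun e => ({e} : Multiset α)) (fun _ _ _ _ h => Multiset.singleton_inj.1 h)
  ground : ∀ i, 1 ≤ i → i ≤ d → (V i).E = symSet M.E i
  restrict : ∀ i, 1 ≤ i → i ≤ d → ∀ a ∈ symSet M.E (d - i), (∀ e ∈ a, ¬ M.IsLoop e) →
    (V i).map (fun x => a + x) (fun _ _ _ _ h => add_left_cancel h) = V d ↾ symSetDvd M.E d a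
  loop : ∀ i, 1 ≤ i → i ≤ d → ∀ a ∈ symSet M.E (d - i), (∃ e ∈ a, M.IsLoop e) →
    (V d).eRk (symSetDvd M.E d a) = 0

/-- A `d`-th symmetric power of `M`: a symmetric quasi power with
`rk (V d) = (rk M + d - 1).choose d`. -/
structure IsSymmetricPower {α : Type*} (M : Matroid α) (d : ℕ)
    (V : ℕ → Matroid (Multiset α)) : Prop extends IsSymmetricQuasiPower M d V where
  rank : ∃ r : ℕ, M.eRank = r ∧ (V d).eRank = ((r + d - 1).choose d : ℕ)

/-- `M` admits a `d`-th symmetric power. -/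
def HasSymmetricPower {α : Type*} (d : ℕ) (M : Matroid α) : Prop :=
  ∃ V : ℕ → Matroid (Multiset α), M.IsSymmetricPower d V

/-- A forbidden minor for the class of finite matroids with `d`-th symmetric power: a finite
matroid outside the class all of whose proper minors are in the class. -/
def IsForbiddenMinor {α : Type*} (d : ℕ) (N : Matroid α) : Prop :=
  N.Finite ∧ ¬ N.HasSymmetricPower d ∧ ∀ N' : Matroid α, N' <m N → N'.HasSymmetricPower d

/-- Isomorphism of matroids: a bijection of the ground sets that preserves and reflects
independence. -/
def IsIsomorphic {α β : Type*} (M : Matroid α) (N : Matroid β) : Prop :=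
  ∃ f : M.E ≃ N.E, ∀ I : Set M.E,
    M.Indep (Subtype.val '' I) ↔ N.Indep (Subtype.val '' (f '' I))

/-- The uniform matroid `U_{k,n}`. -/
def uniform (k n : ℕ) : Matroid (Fin n) :=
  (IndepMatroid.ofFinite (E := univ) finite_univ (fun I => I.ncard ≤ k)
    (by simp)
    (fun I J hJ hIJ => (ncard_le_ncard hIJ (toFinite _)).trans hJ)
    (by
      intro I J _ hJ hIJ
      obtain ⟨e, heJ, heI⟩ := exists_mem_notMem_of_ncard_lt_ncard hIJ (toFinite _)
      refine ⟨e, heJ, heI, ?_⟩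
      rw [ncard_insert_of_notMem heI (toFinite _)]
      exact hIJ.trans_le hJ)
    (fun _ _ => subset_univ _)).matroid

/-- The union of two of the four `(r-2)`-element parts `A`, `B`, `C`, `D` (numbered `0, 1, 2, 3`)
of the ground set `E_r`. -/
def lindstromBlock (r : ℕ) (i j : Fin 4) : Set (Fin 4 × Fin (r - 2)) :=
  {x | x.1 = i ∨ x.1 = j}

/-- The sets `A ∪ B`, `A ∪ C`, `A ∪ D`, `B ∪ C`, `B ∪ D`. -/
def lindstromBlocks (r : ℕ) : Set (Set (Fin 4 × Fin (r - 2))) :=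
  {lindstromBlock r 0 1, lindstromBlock r 0 2, lindstromBlock r 0 3,
    lindstromBlock r 1 2, lindstromBlock r 1 3}

theorem lindstromBlocks_inter {r : ℕ} {H H' : Set (Fin 4 × Fin (r - 2))}
    (hH : H ∈ lindstromBlocks r) (hH' : H' ∈ lindstromBlocks r) (hne : H ≠ H') :
    (H ∩ H').ncard ≤ r - 2 := by
  have key : ∃ k : Fin 4, H ∩ H' ⊆ range (fun x : Fin (r - 2) => (k, x)) := by
    have aux : ∀ i j i' j' : Fin 4, (∃ k, ∀ x, (x = i ∨ x = j) ∧ (x = i' ∨ x = j') → x = k) →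
        ∃ k : Fin 4, lindstromBlock r i j ∩ lindstromBlock r i' j' ⊆
          range (fun x : Fin (r - 2) => (k, x)) := by
      rintro i j i' j' ⟨k, hk⟩
      exact ⟨k, fun x hx => ⟨x.2, Prod.ext (hk x.1 hx).symm rfl⟩⟩
    simp only [lindstromBlocks, mem_insert_iff, mem_singleton_iff] at hH hH'
    rcases hH with rfl | rfl | rfl | rfl | rfl <;> rcases hH' with rfl | rfl | rfl | rfl | rfl <;>
      first
      | exact absurd rfl hne
      | exact aux _ _ _ _ (by decide)
  obtain ⟨k, hk⟩ := key
  refine (ncard_le_ncard hk (toFinite _)).trans ?_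
  rw [← image_univ]
  exact (ncard_image_le finite_univ).trans (by simp)

/-- Lindström's matroid `M(r)` (used for `r ≥ 4`; `M(4)` is the Vámos matroid). Its cyclic flats
are `∅`, the five blocks, of rank `r - 1`, and the ground set, of rank `r`; a set is independent
if and only if it meets each cyclic flat in at most as many elements as the rank of that flat. -/
def lindstrom (r : ℕ) : Matroid (Fin 4 × Fin (r - 2)) :=
  (IndepMatroid.ofFinite (E := univ) finite_univ
    (fun I => I.ncard ≤ r ∧ ∀ H ∈ lindstromBlocks r, (I ∩ H).ncard ≤ r - 1)
    (by simp)
    (fun I J hJ hIJ => ⟨(ncard_le_ncard hIJ (toFinite _)).trans hJ.1, fun H hH =>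
      (ncard_le_ncard (inter_subset_inter_left H hIJ) (toFinite _)).trans (hJ.2 H hH)⟩)
    (by
      intro I J _ hJ hIJ
      have hIr := hIJ.trans_le hJ.1
      obtain ⟨e₀, he₀J, he₀I⟩ := exists_mem_notMem_of_ncard_lt_ncard hIJ (toFinite _)
      have hr : 3 ≤ r := by have := e₀.2.2; omega
      -- it suffices to add an element outside every block that contains `I`
      suffices h : ∃ e ∈ J, e ∉ I ∧
          (I.ncard = r - 1 → ∀ H ∈ lindstromBlocks r, I ⊆ H → e ∉ H) by
        obtain ⟨e, heJ, heI, he⟩ := h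
        refine ⟨e, heJ, heI, ?_, fun H hH => ?_⟩
        · rw [ncard_insert_of_notMem heI (toFinite _)]; exact hIr
        by_contra! hlt
        have h1 := ncard_le_ncard (inter_subset_left : insert e I ∩ H ⊆ _) (toFinite _)
        have h2 := ncard_insert_of_notMem heI (toFinite _)
        have heq : insert e I ∩ H = insert e I :=
          eq_of_subset_of_ncard_le inter_subset_left (by omega) (toFinite _)
        rw [inter_eq_left, insert_subset_iff] at heq
        exact he (by omega) H hH heq.2 heq.1
      by_cases hex : I.ncard = r - 1 ∧ ∃ H ∈ lindstromBlocks r, I ⊆ H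
      · obtain ⟨hI, H, hH, hIH⟩ := hex
        have hJH : ¬ J ⊆ H := fun hJH => by
          have := hJ.2 H hH
          rw [inter_eq_left.2 hJH] at this
          omega
        obtain ⟨e, heJ, heH⟩ := not_subset.1 hJH
        refine ⟨e, heJ, fun h => heH (hIH h), fun _ H' hH' hIH' heH' => ?_⟩
        have hne : H ≠ H' := by rintro rfl; exact heH heH'
        have := (ncard_le_ncard (subset_inter hIH hIH') (toFinite _)).trans
          (lindstromBlocks_inter hH hH' hne)
        omega
      · exact ⟨e₀, he₀J, he₀I, fun hI H hH hIH => absurd ⟨hI, H, hH, hIH⟩ hex⟩)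
    (fun _ _ => subset_univ _)).matroid

/-- The matroid `M(r) ⊕ U_{2,3}`. -/
def lindstromSum (r : ℕ) : Matroid ((Fin 4 × Fin (r - 2)) ⊕ Fin 3) :=
  (lindstrom r).sum (uniform 2 3)

end Matroid

/-!
The degrees of a symmetric power are linked by multiplication with single elements: multiplication
by a nonloop embeds each degree into the next, and a multiple of a loop is a loop
(`IsGradedPower`). The tuples of elements of a base `B` of `M` span every degree. There are exactly
as many of them as the rank that is demanded in the top degree, so they are independent in all
degrees, for every base `B` (`HasSymmetricPower.exists_isGradedPower`).

*Minors.* For an independent set `C`, a power of a restriction of `M ／ C` arises by contracting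
the tuples that are divisible by an element of `C`. That multiplication by a nonloop `b` of the
minor is an embedding again comes down to a modularity statement about sets of tuples of one base
that contains both `C` and `b`; it holds since these tuples are independent
(`Indep.union_indep_of_union_inter`, `HasSymmetricPower.of_isMinor`).

*No second power.* The three points `x`, `y`, `z` of `U_{2,3}` make the copies `xU`, `yU`, `zU` of
the ground set `U` of `M(r)` inside a second power behave like three subspaces `u₁ ⊗ U`, `u₂ ⊗ U`,
`u₃ ⊗ U` for pairwise independent vectors `uᵢ` of a plane. So contracting `xA ∪ yB` has the effect
on `zU` of contracting the intersection of the flats spanned by `A` and `B` in a representation,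
and the usual proof of the Ingleton inequality goes through (`IsGradedPower.ingleton`). The parts of
`M(r)` violate that inequality (`not_hasSymmetricPower_two_lindstromSum`).

*Representable matroids.* If `M` is represented over `ℚ`, the products of the linear forms that
represent the elements of a tuple represent a symmetric power
(`IsRepresentable.hasSymmetricPower`).

*Forbidden minors.* A `d`-th power contains a second one, so `M(r) ⊕ U_{2,3}` has a forbidden minor
`N` for each `d ≥ 2`, and `N` is not representable. All contractions of `M(r)` by one element are
representable, by generic vectors in suitable subspaces (`exists_generic`,
`exists_linearIndepOn_iff_lindstrom_insert`), as is every restriction of `M(r)` without dependent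
`r`-sets. So `N` contracts nothing in `M(r)` and retains a circuit of size `r`, whereas all its
other circuits have size at most `3` or at least `r` (`exists_isCircuit_of_isMinor_lindstromSum`).
Since `r ≥ 4`, the matroid `N` determines `r`.
-/

namespace Matroid

/-! ### Graded symmetric powers -/

section Graded

variable {α β : Type*} {M : Matroid α} {d i j : ℕ} {V : ℕ → Matroid (Multiset α)}
  {E F : Set α} {s t : Multiset α}

theorem cons_mem_symSet {b : α} (hb : b ∈ E) (hs : s ∈ symSet E i) :
    b ::ₘ s ∈ symSet E (i + 1) := by
  refine ⟨by rw [Multiset.card_cons, hs.1], fun e he => ?_⟩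
  rcases Multiset.mem_cons.1 he with rfl | he
  exacts [hb, hs.2 e he]

theorem add_mem_symSet (hs : s ∈ symSet E i) (ht : t ∈ symSet E j) :
    s + t ∈ symSet E (i + j) := by
  refine ⟨by rw [Multiset.card_add, hs.1, ht.1], fun e he => ?_⟩
  rcases Multiset.mem_add.1 he with he | he
  exacts [hs.2 e he, ht.2 e he]

theorem symSet_mono (h : E ⊆ F) (i : ℕ) : symSet E i ⊆ symSet F i :=
  fun _ hs => ⟨hs.1, fun e he => h (hs.2 e he)⟩

theorem symSet_zero (E : Set α) : symSet E 0 = {0} := by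
  ext s
  constructor
  · exact fun hs => Multiset.card_eq_zero.1 hs.1
  · rintro rfl
    exact ⟨rfl, by simp⟩

theorem symSet_one (E : Set α) : symSet E 1 = (fun e => ({e} : Multiset α)) '' E := by
  ext s
  constructor
  · intro hs
    obtain ⟨a, rfl⟩ := Multiset.card_eq_one.1 hs.1
    exact ⟨a, hs.2 a (by simp), rfl⟩
  · rintro ⟨a, ha, rfl⟩
    exact ⟨by simp, by simpa using ha⟩

theorem mem_symSet_succ (hs : s ∈ symSet E (i + 1)) :
    ∃ b ∈ E, ∃ t ∈ symSet E i, s = b ::ₘ t := by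
  obtain ⟨b, hb⟩ : ∃ b, b ∈ s := Multiset.card_pos_iff_exists_mem.1 (by rw [hs.1]; omega)
  obtain ⟨t, rfl⟩ := Multiset.exists_cons_of_mem hb
  refine ⟨b, hs.2 b hb, t, ⟨?_, fun e he => hs.2 e (Multiset.mem_cons_of_mem he)⟩, rfl⟩
  have := hs.1
  rw [Multiset.card_cons] at this
  omega

theorem of_cons_mem_symSet {b : α} (h : b ::ₘ s ∈ symSet E (i + 1)) : s ∈ symSet E i := by
  refine ⟨?_, fun e he => h.2 e (Multiset.mem_cons_of_mem he)⟩
  have := h.1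
  rw [Multiset.card_cons] at this
  omega

theorem replicate_mem_symSet {c : α} (hc : c ∈ E) (i : ℕ) :
    Multiset.replicate i c ∈ symSet E i :=
  ⟨by simp, fun e he => by rwa [Multiset.eq_of_mem_replicate he]⟩

theorem symSet_finite (hE : E.Finite) (i : ℕ) : (symSet E i).Finite := by
  induction i with
  | zero => rw [symSet_zero]; exact finite_singleton _
  | succ i ih =>
    refine (hE.image2 (fun b s => b ::ₘ s) ih).subset fun s hs => ?_
    obtain ⟨b, hb, t, ht, rfl⟩ := mem_symSet_succ hs
    exact mem_image2_of_mem hb ht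

theorem encard_symSet (hE : E.Finite) (d : ℕ) :
    (symSet E d).encard = ((E.ncard + d - 1).choose d : ℕ) := by
  classical
  have := hE.fintype
  have e : Sym E d ≃ symSet E d := Equiv.ofBijective
    (fun s => ⟨(s : Multiset E).map (↑), by simp,
      fun e he => by obtain ⟨a, -, rfl⟩ := Multiset.mem_map.1 he; exact a.2⟩) <| by
    constructor
    · intro s t hst
      exact Subtype.ext (Multiset.map_injective Subtype.val_injective (congrArg Subtype.val hst))
    · rintro ⟨s, hs⟩
      refine ⟨⟨s.attach.map fun a => ⟨a.1, hs.2 a.1 a.2⟩, by simpa using hs.1⟩, ?_⟩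
      apply Subtype.ext
      simp only [Sym.coe_mk, Multiset.map_map, Function.comp_apply]
      exact Multiset.attach_map_val s
  rw [Set.encard, ← ENat.card_congr e, ENat.card_eq_coe_fintype_card, Sym.card_sym_eq_choose,
    ← Nat.card_eq_fintype_card, Nat.card_coe_set_eq]

theorem map_indep_image_iff {f : α → β} (hf : Function.Injective f) {X : Set α} :
    (M.map f hf.injOn).Indep (f '' X) ↔ M.Indep X := by
  rw [map_indep_iff]
  constructor
  · rintro ⟨Y, hY, hXY⟩
    rwa [hf.image_injective hXY]
  · exact fun h => ⟨X, h, rfl⟩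

/-- A map that preserves and reflects independence carries closures into closures. -/
theorem map_mem_closure_of_indep_iff {P : Matroid α} {Q : Matroid β} {f : α → β}
    (hE : f '' P.E ⊆ Q.E) (h : ∀ X ⊆ P.E, (Q.Indep (f '' X) ↔ P.Indep X)) {X : Set α}
    (hX : X ⊆ P.E) {x : α} (hx : x ∈ P.closure X) : f x ∈ Q.closure (f '' X) := by
  obtain ⟨I, hI⟩ := P.exists_isBasis X
  have hxE := mem_ground_of_mem_closure hx
  rw [← hI.closure_eq_closure, hI.indep.mem_closure_iff] at hx
  refine Q.closure_subset_closure (image_mono hI.subset) ?_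
  have hIE := hI.subset.trans hX
  rcases hx with hx | hx
  · rw [((h I hIE).2 hI.indep).mem_closure_iff]
    left
    rw [← image_insert_eq]
    refine ⟨fun hin => hx.not_indep ((h _ (insert_subset hxE hIE)).1 hin), ?_⟩
    exact (image_mono (insert_subset hxE hIE)).trans hE
  · exact Q.mem_closure_of_mem (mem_image_of_mem f hx) ((image_mono hIE).trans hE)

/-- The axioms of a symmetric quasi power in graded form: multiplication by one nonloop at a time
carries each `V i` isomorphically into `V (i + 1)`. Unlike in `IsSymmetricQuasiPower`, the
degree `i = 0` takes part; its ground set is the singleton of the empty tuple. -/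
structure IsGradedPower (M : Matroid α) (d : ℕ) (V : ℕ → Matroid (Multiset α)) : Prop where
  ground : ∀ i ≤ d, (V i).E = symSet M.E i
  one : 1 ≤ d → ∀ X ⊆ M.E, ((V 1).Indep ((fun e => ({e} : Multiset α)) '' X) ↔ M.Indep X)
  mul : ∀ i < d, ∀ b, M.IsNonloop b → ∀ X ⊆ symSet M.E i,
    ((V (i + 1)).Indep ((fun x => b ::ₘ x) '' X) ↔ (V i).Indep X)
  loop : ∀ i ≤ d, ∀ s ∈ symSet M.E i, (∃ e ∈ s, M.IsLoop e) → (V i).IsLoop s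

theorem IsGradedPower.cons_mem_closure (hV : M.IsGradedPower d V) (hi : i < d) {b : α}
    (hb : b ∈ M.E) {X : Set (Multiset α)} (hX : X ⊆ symSet M.E i) (hs : s ∈ (V i).closure X) :
    b ::ₘ s ∈ (V (i + 1)).closure ((fun x => b ::ₘ x) '' X) := by
  have hsE : s ∈ symSet M.E i := hV.ground i hi.le ▸ mem_ground_of_mem_closure hs
  rcases M.isLoop_or_isNonloop b with hl | hn
  · exact (hV.loop (i + 1) hi _ (cons_mem_symSet hb hsE)
      ⟨b, Multiset.mem_cons_self _ _, hl⟩).mem_closure _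
  · refine map_mem_closure_of_indep_iff (f := fun x => b ::ₘ x) ?_ ?_ ?_ hs
    · rw [hV.ground i hi.le, hV.ground (i + 1) hi]
      rintro _ ⟨x, hx, rfl⟩
      exact cons_mem_symSet hb hx
    · rw [hV.ground i hi.le]
      exact hV.mul i hi b hn
    · rwa [hV.ground i hi.le]

theorem IsGradedPower.add_mem_closure (hV : M.IsGradedPower d V) (ht : t ∈ symSet M.E j)
    (hij : i + j ≤ d) {X : Set (Multiset α)} (hX : X ⊆ symSet M.E i)
    (hs : s ∈ (V i).closure X) :
    t + s ∈ (V (i + j)).closure ((fun x => t + x) '' X) := by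
  induction j generalizing t with
  | zero =>
    rw [symSet_zero] at ht
    obtain rfl : t = 0 := ht
    simpa using hs
  | succ j ih =>
    obtain ⟨b, hb, u, hu, rfl⟩ := mem_symSet_succ ht
    have h := hV.cons_mem_closure (i := i + j) (by omega) hb ?_ (ih hu (by omega))
    · rw [image_image] at h
      simp only [Multiset.cons_add]
      exact h
    · rintro _ ⟨x, hx, rfl⟩
      rw [add_comm i j]
      exact add_mem_symSet hu (hX hx)

theorem IsGradedPower.singleton_mem_closure (hV : M.IsGradedPower d V) (hd : 1 ≤ d) {X : Set α}
    (hX : X ⊆ M.E) {e : α} (he : e ∈ M.closure X) :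
    {e} ∈ (V 1).closure ((fun e => ({e} : Multiset α)) '' X) :=
  map_mem_closure_of_indep_iff (f := fun e => ({e} : Multiset α))
    (by rw [hV.ground 1 hd, symSet_one]) (hV.one hd) hX he

/-- The tuples of elements of a base of `M` span each degree: write a tuple as `e b w` with `b` in
the base, span `e w` in one degree less, and multiply by `b`. -/
theorem IsGradedPower.subset_closure_symSet (hV : M.IsGradedPower d V) {B : Set α}
    (hB : M.IsBase B) (hi : i ≤ d) : symSet M.E i ⊆ (V i).closure (symSet B i) := by
  have hBE := hB.subset_ground
  induction i with
  | zero =>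
    rw [symSet_zero, ← symSet_zero B]
    refine (V 0).subset_closure _ ?_
    rw [hV.ground 0 hi, symSet_zero, symSet_zero]
  | succ i ih =>
    rcases Nat.eq_zero_or_pos i with rfl | hi0
    · rw [symSet_one, zero_add]
      rintro _ ⟨e, he, rfl⟩
      rw [symSet_one]
      exact hV.singleton_mem_closure hi hBE (by rwa [hB.closure_eq])
    intro s hs
    obtain ⟨e, he, t, ht, rfl⟩ := mem_symSet_succ hs
    have h1 := hV.cons_mem_closure hi he (symSet_mono hBE i) (ih (by omega) ht)
    have hsub : symSet B (i + 1) ⊆ (V (i + 1)).E := by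
      rw [hV.ground _ hi]; exact symSet_mono hBE _
    refine closure_subset_closure_of_subset_closure ?_ h1
    rintro _ ⟨u, hu, rfl⟩
    obtain ⟨k, rfl⟩ : ∃ k, i = k + 1 := ⟨i - 1, by omega⟩
    obtain ⟨b, hb, w, hw, rfl⟩ := mem_symSet_succ hu
    have h2 : e ::ₘ w ∈ (V (k + 1)).closure (symSet B (k + 1)) :=
      ih (by omega) (cons_mem_symSet he (symSet_mono hBE k hw))
    have h3 := hV.cons_mem_closure hi (hBE hb) (symSet_mono hBE _) h2
    change e ::ₘ b ::ₘ w ∈ _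
    rw [Multiset.cons_swap]
    refine (V (k + 1 + 1)).closure_subset_closure ?_ h3
    rintro _ ⟨x, hx, rfl⟩
    exact cons_mem_symSet hb hx

/-- A graded power in which the tuples from some base are independent gives a symmetric power. -/
theorem IsGradedPower.hasSymmetricPower (hV : M.IsGradedPower d V) (hd : 1 ≤ d) {B : Set α}
    (hB : M.IsBase B) (hfin : B.Finite) (hind : (V d).Indep (symSet B d)) :
    M.HasSymmetricPower d := by
  have key : ∀ j i, i + j ≤ d → ∀ a ∈ symSet M.E j, (∀ e ∈ a, ¬ M.IsLoop e) →
      ∀ X ⊆ symSet M.E i, ((V (i + j)).Indep ((fun x => a + x) '' X) ↔ (V i).Indep X) := by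
    intro j
    induction j with
    | zero =>
      intro i _ a ha _ X _
      rw [symSet_zero] at ha
      obtain rfl : a = 0 := ha
      simp
    | succ j ih =>
      intro i hij a ha hal X hX
      obtain ⟨b, hb, u, hu, rfl⟩ := mem_symSet_succ ha
      have h1 := hV.mul (i + j) (by omega) b
        ((not_isLoop_iff hb).1 (hal b (Multiset.mem_cons_self _ _))) ((fun x => u + x) '' X) (by
          rintro _ ⟨x, hx, rfl⟩
          rw [add_comm i j]
          exact add_mem_symSet hu (hX hx))
      rw [image_image] at h1
      rw [← ih i (by omega) u hu (fun e he => hal e (Multiset.mem_cons_of_mem he)) X hX, ← h1]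
      simp only [Multiset.cons_add]
      rfl
  refine ⟨V, ⟨⟨?_, fun i _ hi => hV.ground i hi, ?_, ?_⟩, B.ncard, ?_, ?_⟩⟩
  · refine ext_indep (by rw [hV.ground 1 hd, symSet_one]; rfl) fun I hI => ?_
    rw [hV.ground 1 hd, symSet_one] at hI
    obtain ⟨X, hX, rfl⟩ := subset_image_iff.1 hI
    exact (hV.one hd X hX).trans (map_indep_image_iff (fun _ _ => Multiset.singleton_inj.1)).symm
  · intro i hi hid a ha hal
    have haE : ∀ x ∈ symSet M.E i, a + x ∈ symSet M.E d := fun x hx => by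
      have := add_mem_symSet ha hx
      rwa [Nat.sub_add_cancel hid] at this
    have himg : (fun x => a + x) '' symSet M.E i = symSetDvd M.E d a := by
      ext s
      constructor
      · rintro ⟨x, hx, rfl⟩
        exact ⟨haE x hx, x, rfl⟩
      · rintro ⟨hs, x, rfl⟩
        refine ⟨x, ⟨?_, fun e he => hs.2 e (Multiset.mem_add.2 (Or.inr he))⟩, rfl⟩
        have := hs.1
        rw [Multiset.card_add, ha.1] at this
        omega
    have hf : Function.Injective fun x => a + x := fun _ _ h => add_left_cancel h
    change (V i).map (fun x => a + x) hf.injOn = _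
    refine ext_indep (by rw [map_ground, hV.ground i hid, himg]; rfl) fun I hI => ?_
    rw [map_ground, hV.ground i hid] at hI
    obtain ⟨X, hX, rfl⟩ := subset_image_iff.1 hI
    have h := key (d - i) i (by omega) a ha hal X hX
    rw [show i + (d - i) = d by omega] at h
    rw [restrict_indep_iff, h, map_indep_image_iff hf, and_iff_left (hI.trans himg.subset)]
  · rintro i - - a - ⟨e, he, hel⟩
    refine (eRk_eq_zero_iff ?_).2 ?_
    · rw [hV.ground d le_rfl]
      exact fun s hs => hs.1
    · rintro _ ⟨hs, x, rfl⟩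
      exact hV.loop d le_rfl _ hs ⟨e, Multiset.mem_add.2 (Or.inl he), hel⟩
  · rw [← hB.encard_eq_eRank, hfin.cast_ncard_eq]
  · rw [← encard_symSet hfin]
    have hbase : (V d).IsBase (symSet B d) := by
      refine hind.isBase_of_ground_subset_closure ?_
      rw [hV.ground d le_rfl]
      exact hV.subset_closure_symSet hB le_rfl
    exact hbase.encard_eq_eRank.symm

/-- In a symmetric power of a matroid with a nonloop, the lower degrees form a graded power in
which the tuples from a base of `M` are independent. The rank condition enters here: the tuples
from a base span, and there are just as many of them as the rank of the top degree. -/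
theorem HasSymmetricPower.exists_isGradedPower (h : M.HasSymmetricPower d) (hd : 1 ≤ d)
    {c : α} (hc : M.IsNonloop c) : ∃ V, M.IsGradedPower d V ∧
      ∀ i ≤ d, ∀ B, M.IsBase B → (V i).Indep (symSet B i) := by
  obtain ⟨V, hV, r, hr, hVr⟩ := h
  have hres : ∀ i, 1 ≤ i → i ≤ d → ∀ a ∈ symSet M.E (d - i), (∀ e ∈ a, ¬ M.IsLoop e) →
      ∀ X ⊆ symSet M.E i, ((V d).Indep ((fun x => a + x) '' X) ↔ (V i).Indep X) := by
    intro i hi hid a ha hal X hX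
    have hsub : (fun x => a + x) '' X ⊆ symSetDvd M.E d a := by
      rintro _ ⟨x, hx, rfl⟩
      have := add_mem_symSet ha (hX hx)
      rw [Nat.sub_add_cancel hid] at this
      exact ⟨this, x, rfl⟩
    have hf : Function.Injective fun x => a + x := fun _ _ h => add_left_cancel h
    have h : (V i).map (fun x => a + x) hf.injOn = _ := hV.restrict i hi hid a ha hal
    rw [← map_indep_image_iff (M := V i) hf, h, restrict_indep_iff, and_iff_left hsub]
  have hone : ∀ X, ((V 1).Indep ((fun e => ({e} : Multiset α)) '' X) ↔ M.Indep X) := by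
    intro X
    rw [hV.one]
    exact map_indep_image_iff (fun _ _ => Multiset.singleton_inj.1)
  have hcl : ∀ k, ∀ e ∈ Multiset.replicate k c, ¬ M.IsLoop e := fun k e he => by
    rw [Multiset.eq_of_mem_replicate he]
    exact hc.not_isLoop
  have hcE := hc.mem_ground
  let W : ℕ → Matroid (Multiset α) := fun i => if i = 0 then freeOn {0} else V i
  have hW0 : W 0 = freeOn {0} := if_pos rfl
  have hW : ∀ i, 1 ≤ i → W i = V i := fun i hi => if_neg (by omega)
  have hgr : M.IsGradedPower d W := by
    constructor
    · intro i hi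
      rcases Nat.eq_zero_or_pos i with rfl | h0
      · rw [hW0, symSet_zero, freeOn_ground]
      · rw [hW i h0, hV.ground i h0 hi]
    · intro _ X _
      rw [hW 1 le_rfl, hone X]
    · intro i hi b hb X hX
      rcases Nat.eq_zero_or_pos i with rfl | h0
      · rw [hW0, hW (0 + 1) le_rfl, zero_add]
        rw [symSet_zero] at hX
        refine iff_of_true ?_ (freeOn_indep_iff.2 hX)
        have hb1 := (hone {b}).2 hb.indep
        refine hb1.subset ?_
        rintro _ ⟨x, hx, rfl⟩
        obtain rfl : x = 0 := hX hx
        exact ⟨b, rfl, rfl⟩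
      · rw [hW i h0, hW (i + 1) (by omega)]
        have h1 := hres (i + 1) (by omega) hi (Multiset.replicate (d - (i + 1)) c)
          (replicate_mem_symSet hcE _) (hcl _) ((fun x => b ::ₘ x) '' X) (by
            rintro _ ⟨x, hx, rfl⟩
            exact cons_mem_symSet hb.mem_ground (hX hx))
        have h2 := hres i h0 hi.le (b ::ₘ Multiset.replicate (d - (i + 1)) c) (by
            have := cons_mem_symSet hb.mem_ground (replicate_mem_symSet hcE (d - (i + 1)))
            rwa [show d - (i + 1) + 1 = d - i by omega] at this) (fun e he => by
            rcases Multiset.mem_cons.1 he with rfl | he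
            exacts [hb.not_isLoop, hcl _ e he]) X hX
        rw [← h1, ← h2, image_image]
        simp only [Multiset.cons_add, Multiset.add_cons]
    · intro i hi s hs hsl
      have hsE : s ∈ (W i).E := by
        rcases Nat.eq_zero_or_pos i with rfl | h0
        · rw [symSet_zero] at hs
          obtain rfl : s = 0 := hs
          simp at hsl
        · rwa [hW i h0, hV.ground i h0 hi]
      rcases Nat.eq_zero_or_pos i with rfl | h0
      · rw [symSet_zero] at hs
        obtain rfl : s = 0 := hs
        simp at hsl
      rw [hW i h0] at hsE ⊢
      rw [← singleton_not_indep hsE]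
      obtain ⟨e, he, hel⟩ := hsl
      obtain ⟨t, rfl⟩ := Multiset.exists_cons_of_mem he
      obtain ⟨k, rfl⟩ : ∃ k, i = k + 1 := ⟨i - 1, by omega⟩
      have ht := of_cons_mem_symSet hs
      rcases Nat.eq_zero_or_pos k with rfl | hk
      · rw [symSet_zero] at ht
        obtain rfl : t = 0 := ht
        intro hcon
        have h1 := (hone {e}).1 (by simpa using hcon)
        exact hel.not_indep_of_mem (mem_singleton e) h1
      · -- `c ^ (d - i) * e * t` lies in the rank-zero set of the multiples of `c ^ (d - i) * e`
        intro hcon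
        rw [← hres (k + 1) h0 hi (Multiset.replicate (d - (k + 1)) c) (replicate_mem_symSet hcE _)
          (hcl _) _ (singleton_subset_iff.2 hs), image_singleton] at hcon
        have ha : e ::ₘ Multiset.replicate (d - (k + 1)) c ∈ symSet M.E (d - k) := by
          have := cons_mem_symSet hel.mem_ground (replicate_mem_symSet hcE (d - (k + 1)))
          rwa [show d - (k + 1) + 1 = d - k by omega] at this
        have h0 := hV.loop k hk (by omega) _ ha ⟨e, Multiset.mem_cons_self _ _, hel⟩
        have hmem : Multiset.replicate (d - (k + 1)) c + e ::ₘ t ∈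
            symSetDvd M.E d (e ::ₘ Multiset.replicate (d - (k + 1)) c) := by
          refine ⟨?_, t, by simp⟩
          have := add_mem_symSet (replicate_mem_symSet hcE (d - (k + 1))) hs
          rwa [show d - (k + 1) + (k + 1) = d by omega] at this
        have h1 := hcon.encard_le_eRk_of_subset (singleton_subset_iff.2 hmem)
        rw [h0] at h1
        simp at h1
  refine ⟨W, hgr, fun i hi B hB => ?_⟩
  have hBfin : B.Finite := by
    rw [← encard_lt_top_iff, hB.encard_eq_eRank, hr]
    exact ENat.natCast_lt_top r
  have hdB : (W d).Indep (symSet B d) := by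
    have hBr : B.ncard = r := by
      have := hB.encard_eq_eRank
      rw [hr, ← hBfin.cast_ncard_eq] at this
      exact_mod_cast this
    refine IsRkFinite.indep_of_encard_le_eRk
      (isRkFinite_of_finite _ (symSet_finite hBfin d)) ?_
    rw [encard_symSet hBfin, hBr, ← hVr, ← hW d hd, ← eRk_ground, hgr.ground d le_rfl,
      ← eRk_closure_eq _ (symSet B d)]
    exact eRk_mono _ (hgr.subset_closure_symSet hB le_rfl)
  rcases Nat.eq_zero_or_pos i with rfl | h0
  · rw [hW0, symSet_zero]
    exact freeOn_indep_iff.2 subset_rfl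
  obtain ⟨b, hb⟩ : B.Nonempty := by
    rw [nonempty_iff_ne_empty]
    rintro rfl
    have : c ∈ M.closure ∅ := by rw [hB.closure_eq]; exact hcE
    exact hc.not_isLoop this
  rw [hW i h0, ← hres i h0 hi (Multiset.replicate (d - i) b)
    (replicate_mem_symSet (hB.subset_ground hb) _) (fun e he => by
      rw [Multiset.eq_of_mem_replicate he]
      exact (hB.indep.isNonloop_of_mem hb).not_isLoop) _ (symSet_mono hB.subset_ground i)]
  rw [hW d hd] at hdB
  refine hdB.subset ?_
  rintro _ ⟨x, hx, rfl⟩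
  have := add_mem_symSet (replicate_mem_symSet hb (d - i)) hx
  rwa [Nat.sub_add_cancel hi] at this

/-- A matroid all of whose elements are loops has symmetric powers, all of rank zero. -/
theorem hasSymmetricPower_of_eRank_eq_zero (hd : 1 ≤ d) (h : M.eRank = 0) :
    M.HasSymmetricPower d := by
  have hl : ∀ e ∈ M.E, M.IsLoop e := by
    have := eRank_eq_zero_iff.1 h
    intro e he
    rw [this]
    simpa using he
  refine (IsGradedPower.hasSymmetricPower (V := fun i => if i = 0 then freeOn {0} else
    loopyOn (symSet M.E i)) (B := ∅) ?_ hd ?_ finite_empty ?_)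
  · constructor
    · rintro (_ | i) _
      · simp [symSet_zero]
      · simp
    · intro _ X hX
      rw [if_neg one_ne_zero, loopyOn_indep_iff, image_eq_empty]
      constructor
      · rintro rfl
        exact M.empty_indep
      · exact fun hI => hI.eq_empty_of_subset_loops fun e he => hl e (hX he)
    · exact fun i _ b hb _ _ => absurd (hl b hb.mem_ground) hb.not_isLoop
    · rintro (_ | i) hi s hs hsl
      · rw [symSet_zero] at hs
        obtain rfl : s = 0 := hs
        simp at hsl
      · simpa using hs
  · rw [eRank_eq_zero_iff.1 h]
    simp
  · have : symSet (∅ : Set α) d = ∅ := by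
      refine eq_empty_of_forall_notMem fun s hs => ?_
      obtain ⟨k, rfl⟩ : ∃ k, d = k + 1 := ⟨d - 1, by omega⟩
      obtain ⟨b, hb, -⟩ := mem_symSet_succ hs
      exact hb
    rw [this]
    exact empty_indep _

end Graded

/-! ### Minors of matroids with a symmetric power -/

section Minor

variable {α : Type*} {M N : Matroid α} {d i : ℕ} {V : ℕ → Matroid (Multiset α)}
  {B C F : Set α}

/-- Two parts `S`, `T` of a finite independent set span a modular pair of flats, so a set `Y` in the
span of `S` that is independent over `S ∩ T` is independent over `T`. -/
theorem Indep.union_indep_of_union_inter {P : Matroid α} {S T Y : Set α}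
    (hST : P.Indep (S ∪ T)) (hfin : (S ∪ T).Finite) (hYS : Y ⊆ P.closure S)
    (hY : P.Indep (Y ∪ S ∩ T)) : P.Indep (Y ∪ T) := by
  have hS := hST.subset subset_union_left
  have hT := hST.subset subset_union_right
  obtain ⟨Q, hQ, hYQ⟩ := hY.subset_isBasis_of_subset (X := P.closure S)
    (union_subset hYS (inter_subset_left.trans (P.subset_closure S hS.subset_ground)))
    (P.closure_subset_ground S)
  have hSfin := hfin.subset subset_union_left
  have hTfin := hfin.subset subset_union_right
  have hQS : Q.encard = S.encard := by
    rw [hQ.encard_eq_eRk, eRk_closure_eq, hS.eRk_eq_encard]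
  have hQfin : Q.Finite := by
    rw [← encard_lt_top_iff, hQS]
    exact hSfin.encard_lt_top
  refine (IsRkFinite.indep_of_encard_le_eRk (I := Q ∪ T)
    (isRkFinite_of_finite _ (hQfin.union hTfin)) ?_).subset
    (union_subset_union_left T (subset_union_left.trans hYQ))
  have h1 : P.eRk (S ∪ T) ≤ P.eRk (Q ∪ T) := by
    rw [← P.eRk_closure_eq (Q ∪ T)]
    refine P.eRk_mono (union_subset ?_ ?_)
    · exact (P.subset_closure S hS.subset_ground).trans
        (hQ.subset_closure.trans (P.closure_subset_closure subset_union_left))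
    · exact (P.subset_closure T hT.subset_ground).trans
        (P.closure_subset_closure subset_union_right)
  refine le_trans ?_ h1
  rw [hST.eRk_eq_encard]
  have h2 := encard_union_add_encard_inter Q T
  rw [hQS, ← encard_union_add_encard_inter S T] at h2
  have h3 : (S ∩ T).encard ≤ (Q ∩ T).encard :=
    encard_le_encard (subset_inter (subset_union_right.trans hYQ) inter_subset_right)
  have h4 : (S ∩ T).encard ≠ ⊤ := ((hSfin.inter_of_left T).encard_lt_top).ne
  refine (ENat.add_le_add_iff_right h4).1 ?_
  rw [← h2]
  gcongr

/-- The `i`-tuples of elements of `E` that are divisible by an element of `C`. -/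
def symSetMeet (E C : Set α) (i : ℕ) : Set (Multiset α) := {s ∈ symSet E i | ∃ c ∈ C, c ∈ s}

theorem symSetMeet_subset {E : Set α} : symSetMeet E C i ⊆ symSet E i := fun _ hs => hs.1

/-- The multiples of the elements of `C` are spanned by those that are tuples of a base through `C`,
because `c` times a tuple is spanned by `c` times the tuples of the base. -/
theorem IsGradedPower.isBasis_symSetMeet (hV : M.IsGradedPower d V)
    (hind : ∀ i ≤ d, ∀ B, M.IsBase B → (V i).Indep (symSet B i)) (hB : M.IsBase B)
    (hCB : C ⊆ B) (hi : i ≤ d) : (V i).IsBasis (symSetMeet B C i) (symSetMeet M.E C i) := by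
  have hBE := hB.subset_ground
  rw [isBasis_iff_indep_subset_closure]
  refine ⟨(hind i hi B hB).subset symSetMeet_subset,
    fun s hs => ⟨symSet_mono hBE i hs.1, hs.2⟩, ?_⟩
  rintro s ⟨hs, c, hc, hcs⟩
  obtain ⟨t, rfl⟩ := Multiset.exists_cons_of_mem hcs
  obtain ⟨k, rfl⟩ : ∃ k, i = k + 1 := ⟨i - 1, by
    have := hs.1
    rw [Multiset.card_cons] at this
    omega⟩
  have h := hV.cons_mem_closure hi (hBE (hCB hc)) (symSet_mono hBE k)
    (hV.subset_closure_symSet hB (by omega) (of_cons_mem_symSet hs))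
  refine (V (k + 1)).closure_subset_closure ?_ h
  rintro _ ⟨x, hx, rfl⟩
  exact ⟨cons_mem_symSet (hCB hc) hx, c, hc, Multiset.mem_cons_self _ _⟩

/-- The power of `M ／ C ↾ F` that is induced by a graded power of `M`. -/
def minorPower (M : Matroid α) (V : ℕ → Matroid (Multiset α)) (C F : Set α) (i : ℕ) :
    Matroid (Multiset α) :=
  (V i ／ symSetMeet M.E C i) ↾ symSet F i

theorem IsGradedPower.minorPower_indep_iff (hV : M.IsGradedPower d V)
    (hind : ∀ i ≤ d, ∀ B, M.IsBase B → (V i).Indep (symSet B i)) (hB : M.IsBase B)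
    (hCB : C ⊆ B) (hi : i ≤ d) (hFC : Disjoint F C)
    {X : Set (Multiset α)} (hX : X ⊆ symSet F i) :
    (minorPower M V C F i).Indep X ↔ (V i).Indep (X ∪ symSetMeet B C i) := by
  rw [minorPower, restrict_indep_iff, and_iff_left hX,
    (hV.isBasis_symSetMeet hind hB hCB hi).contract_indep_iff, and_iff_left]
  rw [disjoint_left]
  rintro s ⟨-, c, hc, hcs⟩ hsX
  exact hFC.ne_of_mem ((hX hsX).2 c hcs) hc rfl

/-- Multiplication by a nonloop `b` of the minor preserves and reflects independence over the
multiples of the elements of `C`: among the tuples of a base through `C` and `b`, the multiples of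
`b` and those of the elements of `C` span a modular pair of flats, and the tuples that they have in
common are `b` times the multiples of elements of `C` of one degree less. -/
theorem IsGradedPower.minorPower (hV : M.IsGradedPower d V) [M.RankFinite]
    (hind : ∀ i ≤ d, ∀ B, M.IsBase B → (V i).Indep (symSet B i)) (hC : M.Indep C)
    (hF : F ⊆ M.E) (hFC : Disjoint F C) :
    ((M ／ C) ↾ F).IsGradedPower d (M.minorPower V C F) := by
  obtain ⟨B₀, hB₀, hCB₀⟩ := hC.exists_isBase_superset
  constructor
  · exact fun i hi => rfl
  · intro hd X hX
    change X ⊆ F at hX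
    rw [hV.minorPower_indep_iff hind hB₀ hCB₀ hd hFC (by rw [symSet_one]; exact image_mono hX),
      restrict_indep_iff, and_iff_left hX, hC.contract_indep_iff,
      and_iff_right (hFC.mono_left hX), ← hV.one hd _ (union_subset (hX.trans hF)
        hC.subset_ground), image_union]
    have : symSetMeet B₀ C 1 = (fun e => ({e} : Multiset α)) '' C := by
      ext s
      constructor
      · rintro ⟨hs, c, hc, hcs⟩
        rw [symSet_one] at hs
        obtain ⟨e, he, rfl⟩ := hs
        rw [Multiset.mem_singleton] at hcs
        exact ⟨e, hcs ▸ hc, rfl⟩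
      · rintro ⟨e, he, rfl⟩
        exact ⟨by rw [symSet_one]; exact ⟨e, hCB₀ he, rfl⟩, e, he, Multiset.mem_singleton_self e⟩
    rw [this]
  · intro i hi b hb X hX
    change X ⊆ symSet F i at hX
    rw [restrict_isNonloop_iff, ← indep_singleton, hC.contract_indep_iff] at hb
    obtain ⟨⟨hbC, hbi⟩, hbF⟩ := hb
    have hbC : b ∉ C := by simpa using hbC
    obtain ⟨B, hB, hbB⟩ := hbi.exists_isBase_superset
    have hbB' : b ∈ B := hbB (Or.inl rfl)
    have hCB : C ⊆ B := subset_union_right.trans hbB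
    have hBE := hB.subset_ground
    have hbn : M.IsNonloop b := hB.indep.isNonloop_of_mem hbB'
    rw [hV.minorPower_indep_iff hind hB hCB hi hFC (by
        rintro _ ⟨x, hx, rfl⟩
        exact cons_mem_symSet hbF (hX hx)),
      hV.minorPower_indep_iff hind hB hCB hi.le hFC hX,
      ← hV.mul i hi b hbn _ (union_subset (hX.trans (symSet_mono hF i))
        (symSetMeet_subset.trans (symSet_mono hBE i))), image_union]
    constructor
    · refine fun h => h.subset (union_subset_union_right _ ?_)
      rintro _ ⟨x, ⟨hx, c, hc, hcx⟩, rfl⟩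
      exact ⟨cons_mem_symSet hbB' hx, c, hc, Multiset.mem_cons_of_mem hcx⟩
    · intro h
      have hsub : (fun x => b ::ₘ x) '' symSet B i ∪ symSetMeet B C (i + 1) ⊆
          symSet B (i + 1) := by
        refine union_subset ?_ symSetMeet_subset
        rintro _ ⟨x, hx, rfl⟩
        exact cons_mem_symSet hbB' hx
      refine Indep.union_indep_of_union_inter (S := (fun x => b ::ₘ x) '' symSet B i)
        ((hind (i + 1) hi B hB).subset hsub)
        ((symSet_finite hB.finite (i + 1)).subset hsub) ?_ (h.subset ?_)
      · rintro _ ⟨x, hx, rfl⟩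
        exact hV.cons_mem_closure hi hbn.mem_ground (symSet_mono hBE i)
          (hV.subset_closure_symSet hB hi.le (symSet_mono hF i (hX hx)))
      · refine union_subset_union_right _ ?_
        rintro _ ⟨⟨x, hx, rfl⟩, -, c, hc, hcx⟩
        rcases Multiset.mem_cons.1 hcx with rfl | hcx
        · exact absurd hc hbC
        · exact ⟨x, ⟨hx, c, hc, hcx⟩, rfl⟩
  · rintro i hi s hs ⟨e, he, hel⟩
    change s ∈ symSet F i at hs
    rw [restrict_isLoop_iff] at hel
    have hel' : (M ／ C).IsLoop e := by
      refine hel.2.resolve_right fun h => h ⟨hF hel.1, fun hc => hFC.ne_of_mem hel.1 hc rfl⟩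
    rw [contract_isLoop_iff_mem_closure] at hel'
    rw [Matroid.minorPower, restrict_isLoop_iff, and_iff_right hs]
    left
    rw [contract_isLoop_iff_mem_closure]
    refine ⟨?_, fun ⟨_, c, hc, hcs⟩ => hFC.ne_of_mem (hs.2 c hcs) hc rfl⟩
    obtain ⟨t, rfl⟩ := Multiset.exists_cons_of_mem he
    obtain ⟨k, rfl⟩ : ∃ k, i = 1 + k := ⟨i - 1, by
      have := hs.1
      rw [Multiset.card_cons] at this
      omega⟩
    have ht : t ∈ symSet M.E k := by
      rw [add_comm] at hs
      exact symSet_mono hF k (of_cons_mem_symSet hs)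
    have h := hV.add_mem_closure ht (i := 1) hi (by
        rw [symSet_one]; exact image_mono hC.subset_ground)
      (hV.singleton_mem_closure (by omega) hC.subset_ground hel'.1)
    rw [add_comm t, Multiset.singleton_add] at h
    refine (V (1 + k)).closure_subset_closure ?_ h
    rintro _ ⟨_, ⟨c, hc, rfl⟩, rfl⟩
    refine ⟨?_, c, hc, by simp⟩
    change t + {c} ∈ _
    rw [add_comm t, Multiset.singleton_add, add_comm 1 k]
    exact cons_mem_symSet (hC.subset_ground hc) ht

theorem HasSymmetricPower.of_isMinor (h : M.HasSymmetricPower d) (hd : 1 ≤ d) (hNM : N ≤m M) :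
    N.HasSymmetricPower d := by
  by_cases hN : N.eRank = 0
  · exact hasSymmetricPower_of_eRank_eq_zero hd hN
  obtain ⟨c, hc⟩ : ∃ c, N.IsNonloop c := by
    by_contra! hcon
    refine hN ?_
    rw [← eRk_ground, eRk_eq_zero_iff]
    exact fun e he => (not_isNonloop_iff he).1 (hcon e)
  obtain ⟨V, hV, hind⟩ := h.exists_isGradedPower hd (hc.of_isMinor hNM)
  have : M.RankFinite := by
    obtain ⟨-, -, r, hr, -⟩ := h
    rw [← eRank_ne_top_iff, hr]
    exact ENat.natCast_ne_top r
  obtain ⟨C₀, D₀, hC₀, -, -, rfl⟩ := hNM.exists_eq_contract_delete_disjoint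
  obtain ⟨C, hC⟩ := M.exists_isBasis C₀
  obtain ⟨F, hF, hFC, hN⟩ : ∃ F ⊆ M.E, Disjoint F C ∧ M ／ C₀ ＼ D₀ = (M ／ C) ↾ F := by
    refine ⟨(M.E \ C) \ ((C₀ \ C) ∪ D₀), sdiff_subset.trans sdiff_subset,
      disjoint_sdiff_left.mono_left sdiff_subset, ?_⟩
    rw [hC.contract_eq_contract_delete, delete_delete]
    rfl
  rw [hN]
  obtain ⟨B₀, hB₀⟩ := ((M ／ C) ↾ F).exists_isBase
  have hB₀C := hB₀.indep
  rw [restrict_indep_iff, hC.indep.contract_indep_iff] at hB₀C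
  obtain ⟨B, hB, hBsub⟩ := hB₀C.1.2.exists_isBase_superset
  refine (hV.minorPower hind hC.indep hF hFC).hasSymmetricPower hd hB₀
    (hB.finite.subset (subset_union_left.trans hBsub)) ?_
  rw [hV.minorPower_indep_iff hind hB (subset_union_right.trans hBsub) le_rfl hFC
    (symSet_mono hB₀C.2 d)]
  exact (hind d le_rfl B hB).subset
    (union_subset (symSet_mono (subset_union_left.trans hBsub) d) symSetMeet_subset)

end Minor

/-! ### The Ingleton inequality from a second symmetric power -/

section Ingleton

variable {α : Type*} {M : Matroid α} {V : ℕ → Matroid (Multiset α)} {X I J S T U A B C D : Set α}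
  {x y z e : α}

/-- The pairs `xe` with `e ∈ S`. -/
def pairs (x : α) (S : Set α) : Set (Multiset α) := (fun e => x ::ₘ ({e} : Multiset α)) '' S

theorem pairs_union (x : α) (S T : Set α) : pairs x (S ∪ T) = pairs x S ∪ pairs x T :=
  image_union _ _ _

theorem pairs_mono (x : α) (h : S ⊆ T) : pairs x S ⊆ pairs x T := image_mono h

theorem pairs_subset_symSet {E : Set α} (hx : x ∈ E) (hS : S ⊆ E) : pairs x S ⊆ symSet E 2 := by
  rintro _ ⟨e, he, rfl⟩
  refine cons_mem_symSet hx ?_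
  rw [symSet_one]
  exact ⟨e, hS he, rfl⟩

theorem encard_pairs (x : α) (S : Set α) : (pairs x S).encard = S.encard :=
  Function.Injective.encard_image
    (fun _ _ h => Multiset.singleton_inj.1 ((Multiset.cons_inj_right x).1 h)) _

theorem IsGradedPower.pairs_mem_closure (hV : M.IsGradedPower 2 V) (hx : x ∈ M.E) (hX : X ⊆ M.E)
    (he : e ∈ M.closure X) : x ::ₘ {e} ∈ (V 2).closure (pairs x X) := by
  have h := hV.cons_mem_closure (i := 1) (by omega) hx
    (by rw [symSet_one]; exact image_mono hX) (hV.singleton_mem_closure (by omega) hX he)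
  rwa [image_image] at h

theorem IsGradedPower.pairs_mem_closure_pair (hV : M.IsGradedPower 2 V) (he : e ∈ M.E)
    (hy : y ∈ M.E) (hz : z ∈ M.E) (hx : x ∈ M.closure {y, z}) :
    x ::ₘ {e} ∈ (V 2).closure {y ::ₘ {e}, z ::ₘ {e}} := by
  have h := hV.pairs_mem_closure he (pair_subset hy hz) hx
  rw [pairs, image_pair] at h
  have hc : ∀ u : α, e ::ₘ ({u} : Multiset α) = u ::ₘ {e} := fun u => Multiset.cons_swap e u 0
  rwa [hc, hc, hc] at h

theorem IsGradedPower.pairs_subset_closure_union (hV : M.IsGradedPower 2 V) (hS : S ⊆ M.E)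
    (hy : y ∈ M.E) (hz : z ∈ M.E) (hx : x ∈ M.closure {y, z}) :
    pairs x S ⊆ (V 2).closure (pairs y S ∪ pairs z S) := by
  rintro _ ⟨e, he, rfl⟩
  refine (V 2).closure_subset_closure ?_ (hV.pairs_mem_closure_pair (hS he) hy hz hx)
  exact pair_subset (Or.inl ⟨e, he, rfl⟩) (Or.inr ⟨e, he, rfl⟩)

theorem IsGradedPower.eRk_pairs_le (hV : M.IsGradedPower 2 V) (hx : x ∈ M.E) (hS : S ⊆ M.E) :
    (V 2).eRk (pairs x S) ≤ M.eRk S := by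
  obtain ⟨I, hI⟩ := M.exists_isBasis S
  rw [← hI.encard_eq_eRk, ← encard_pairs x I]
  refine le_trans ?_ ((V 2).eRk_le_encard _)
  rw [← eRk_closure_eq _ (pairs x I)]
  refine eRk_mono _ ?_
  rintro _ ⟨e, he, rfl⟩
  exact hV.pairs_mem_closure hx (hI.subset.trans hS) (hI.subset_closure he)

/-- Multiples by two different points `x`, `y` are skew, provided that every independent subset of
the first factor stays independent on adding `x` and `y`. -/
theorem IsGradedPower.add_eRk_le_eRk_pairs_union (hV : M.IsGradedPower 2 V)
    (hind : ∀ i ≤ 2, ∀ B, M.IsBase B → (V i).Indep (symSet B i)) [M.RankFinite] (hxy : x ≠ y)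
    (hyS : y ∉ S) (hS : S ⊆ M.E) (hT : T ⊆ M.E)
    (hSxy : ∀ I ⊆ S, M.Indep I → M.Indep (I ∪ {x, y})) :
    M.eRk S + M.eRk T ≤ (V 2).eRk (pairs x S ∪ pairs y T) := by
  obtain ⟨I, hI⟩ := M.exists_isBasis S
  obtain ⟨J, hJ⟩ := M.exists_isBasis T
  obtain ⟨B, hB, hIB⟩ := (hSxy I hI.subset hI.indep).exists_isBase_superset
  have hxB : x ∈ B := hIB (by simp)
  have hyB : y ∈ B := hIB (by simp)
  have hyI : y ∉ I := fun h => hyS (hI.subset h)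
  have hBE := hB.subset_ground
  have hyn := hB.indep.isNonloop_of_mem hyB
  -- a coincidence `ye = xi` with `i ∈ I` would force `y = i`
  have hdis : ∀ K : Set α, Disjoint (pairs y K) (pairs x I) := by
    intro K
    rw [disjoint_left]
    rintro _ ⟨e, he, rfl⟩ ⟨i, hi, hie⟩
    have : y ∈ x ::ₘ ({i} : Multiset α) := by
      change x ::ₘ ({i} : Multiset α) = y ::ₘ {e} at hie
      rw [hie]
      exact Multiset.mem_cons_self _ _
    rcases Multiset.mem_cons.1 this with h | h
    · exact hxy h.symm
    · rw [Multiset.mem_singleton] at h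
      exact hyI (h ▸ hi)
  have hsub : pairs y B ∪ pairs x I ⊆ symSet B 2 :=
    union_subset (pairs_subset_symSet hyB subset_rfl)
      (pairs_subset_symSet hxB (subset_union_left.trans hIB))
  have hindep : (V 2).Indep (pairs y J ∪ pairs x I) := by
    refine Indep.union_indep_of_union_inter (S := pairs y B)
      ((hind 2 le_rfl B hB).subset hsub) ((symSet_finite hB.finite 2).subset hsub) ?_ ?_
    · rintro _ ⟨e, he, rfl⟩
      refine hV.pairs_mem_closure (hBE hyB) hBE ?_
      rw [hB.closure_eq]
      exact hJ.indep.subset_ground he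
    · rw [(hdis B).inter_eq, union_empty]
      have h1 := (hV.one (by omega) J hJ.indep.subset_ground).2 hJ.indep
      have h2 := (hV.mul 1 (by omega) y hyn _ (by
        rw [symSet_one]; exact image_mono hJ.indep.subset_ground)).2 h1
      rwa [image_image] at h2
  rw [← hI.encard_eq_eRk, ← hJ.encard_eq_eRk, add_comm, ← encard_pairs x I, ← encard_pairs y J,
    ← encard_union_eq (hdis J)]
  exact hindep.encard_le_eRk_of_subset
    (union_subset ((pairs_mono y hJ.subset).trans subset_union_right)
      ((pairs_mono x hI.subset).trans subset_union_left))

/-- **Ingleton inequality.** Suppose that `M` has a second symmetric power and that `x`, `y`, `z`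
are collinear points on a line that is skew to a set `U`. Then the rank function of `M` satisfies
the Ingleton inequality on `U`. Inside the power, the set `xA ∪ yB` meets the copy `zU` of `U` as
an intersection of the flats spanned by `A` and `B` would, so that contracting it simulates
contracting the common information of `A` and `B`. -/
theorem IsGradedPower.ingleton (hV : M.IsGradedPower 2 V)
    (hind : ∀ i ≤ 2, ∀ B, M.IsBase B → (V i).Indep (symSet B i)) [M.RankFinite]
    (hxy : x ≠ y) (hxz : x ≠ z) (hxcl : x ∈ M.closure {y, z}) (hycl : y ∈ M.closure {x, z})
    (hzE : z ∈ M.E) (hUE : U ⊆ M.E) (hyU : y ∉ U) (hzU : z ∉ U)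
    (hUy : ∀ I ⊆ U, M.Indep I → M.Indep (I ∪ {x, y}))
    (hUz : ∀ I ⊆ U, M.Indep I → M.Indep (I ∪ {x, z}))
    (hA : A ⊆ U) (hB : B ⊆ U) (hC : C ⊆ U) (hD : D ⊆ U) :
    M.eRk A + M.eRk B + M.eRk (A ∪ B ∪ C) + M.eRk (A ∪ B ∪ D) + M.eRk (C ∪ D) ≤
      M.eRk (A ∪ B) + M.eRk (A ∪ C) + M.eRk (A ∪ D) + M.eRk (B ∪ C) + M.eRk (B ∪ D) := by
  have hxE : x ∈ M.E := mem_ground_of_mem_closure hxcl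
  have hyE : y ∈ M.E := mem_ground_of_mem_closure hycl
  have hVfin : (V 2).RankFinite := by
    obtain ⟨B₀, hB₀⟩ := M.exists_isBase
    have h := hV.subset_closure_symSet hB₀ le_rfl
    rw [← eRank_lt_top_iff, ← eRk_ground, hV.ground 2 le_rfl]
    calc (V 2).eRk (symSet M.E 2) ≤ (V 2).eRk (symSet B₀ 2) := by
          rw [← eRk_closure_eq _ (symSet B₀ 2)]; exact eRk_mono _ h
      _ ≤ (symSet B₀ 2).encard := eRk_le_encard _ _
      _ < ⊤ := (symSet_finite hB₀.finite 2).encard_lt_top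
  have hf : ∀ X, ∃ k : ℕ, (V 2).eRk X = k := fun X =>
    ENat.ne_top_iff_exists.1 (eRk_ne_top_iff.2 ((V 2).isRkFinite_set X)) |>.imp fun _ h => h.symm
  have hg : ∀ X, ∃ k : ℕ, M.eRk X = k := fun X =>
    ENat.ne_top_iff_exists.1 (eRk_ne_top_iff.2 (M.isRkFinite_set X)) |>.imp fun _ h => h.symm
  choose f hf using hf
  choose r hr using hg
  have hmono : ∀ X Y, X ⊆ (V 2).closure Y → f X ≤ f Y := fun X Y h => by
    have := (V 2).eRk_mono h
    rw [eRk_closure_eq, hf, hf] at this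
    exact_mod_cast this
  have hmono' : ∀ X Y, X ⊆ Y → f X ≤ f Y := fun X Y h => by
    have := (V 2).eRk_mono h
    rw [hf, hf] at this
    exact_mod_cast this
  have hsubmod : ∀ X Y, f (X ∩ Y) + f (X ∪ Y) ≤ f X + f Y := fun X Y => by
    have := (V 2).eRk_inter_add_eRk_union_le X Y
    rw [hf, hf, hf, hf] at this
    exact_mod_cast this
  have hle : ∀ u ∈ M.E, ∀ S ⊆ U, f (pairs u S) ≤ r S := fun u hu S hS => by
    have := hV.eRk_pairs_le hu (hS.trans hUE)
    rw [hf, hr] at this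
    exact_mod_cast this
  have hskew : ∀ u, x ≠ u → u ∉ U → (∀ I ⊆ U, M.Indep I → M.Indep (I ∪ {x, u})) →
      ∀ S T, S ⊆ U → T ⊆ U → r S + r T ≤ f (pairs x S ∪ pairs u T) :=
    fun u hxu huU hu S T hS hT => by
    have := hV.add_eRk_le_eRk_pairs_union hind hxu (fun h => huU (hS h)) (hS.trans hUE)
      (hT.trans hUE) (fun I hI => hu I (hI.trans hS))
    rw [hf, hr, hr] at this
    exact_mod_cast this
  have hskewy := hskew y hxy hyU hUy
  have hskewz := hskew z hxz hzU hUz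
  have hcl : ∀ {u S W}, u ∈ M.E → S ⊆ U → pairs u S ⊆ W → W ⊆ symSet M.E 2 →
      pairs u S ⊆ (V 2).closure W := fun _ _ h hW =>
    h.trans ((V 2).subset_closure _ (hW.trans (hV.ground 2 le_rfl).superset))
  have hps : ∀ {u S}, u ∈ M.E → S ⊆ U → pairs u S ⊆ symSet M.E 2 := fun hu hS =>
    pairs_subset_symSet hu (hS.trans hUE)
  set W := pairs x A ∪ pairs y B with hW
  have hWs : W ⊆ symSet M.E 2 := union_subset (hps hxE hA) (hps hyE hB)
  have hAB : A ∪ B ⊆ U := union_subset hA hB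
  -- `xA ∪ yB ∪ zS` spans `x(A ∪ B)` as soon as `S` contains `B`
  have hlow : ∀ S, S ⊆ U → B ⊆ S → r (A ∪ B) + r S ≤ f (W ∪ pairs z S) := by
    intro S hS hBS
    refine (hskewz _ _ hAB hS).trans (hmono _ _ ?_)
    have hs : W ∪ pairs z S ⊆ symSet M.E 2 := union_subset hWs (hps hzE hS)
    rw [pairs_union]
    refine union_subset (union_subset
      (hcl hxE hA (subset_union_left.trans subset_union_left) hs) ?_)
      (hcl hzE hS subset_union_right hs)
    refine (hV.pairs_subset_closure_union (hB.trans hUE) hyE hzE hxcl).trans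
      ((V 2).closure_subset_closure ?_)
    exact union_subset (subset_union_right.trans subset_union_left)
      ((pairs_mono z hBS).trans subset_union_right)
  have hbound : ∀ S, S ⊆ U →
      f (W ∪ pairs z S) + r (A ∪ B ∪ S) ≤ r (A ∪ B) + r (A ∪ S) + r (B ∪ S) := by
    intro S hS
    have hAS : A ∪ S ⊆ U := union_subset hA hS
    have hBS : B ∪ S ⊆ U := union_subset hB hS
    have h1 : f (W ∪ pairs z (A ∪ S)) ≤ r (A ∪ B) + r (A ∪ S) := by
      have hs : pairs y (A ∪ B) ∪ pairs z (A ∪ S) ⊆ symSet M.E 2 :=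
        union_subset (hps hyE hAB) (hps hzE hAS)
      have ha : f (W ∪ pairs z (A ∪ S)) ≤ f (pairs y (A ∪ B) ∪ pairs z (A ∪ S)) := by
        refine hmono _ _ (union_subset (union_subset ?_ ?_) ?_)
        · refine (hV.pairs_subset_closure_union (hA.trans hUE) hyE hzE hxcl).trans
            ((V 2).closure_subset_closure (union_subset_union ?_ ?_))
          exacts [pairs_mono y subset_union_left, pairs_mono z subset_union_left]
        · exact hcl hyE hB ((pairs_mono y subset_union_right).trans subset_union_left) hs
        · exact hcl hzE hAS subset_union_right hs
      have hb := hsubmod (pairs y (A ∪ B)) (pairs z (A ∪ S))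
      have hc := hle y hyE _ hAB
      have hd := hle z hzE _ hAS
      omega
    have h2 : f (W ∪ pairs z (B ∪ S)) ≤ r (A ∪ B) + r (B ∪ S) := by
      have hs : pairs x (A ∪ B) ∪ pairs z (B ∪ S) ⊆ symSet M.E 2 :=
        union_subset (hps hxE hAB) (hps hzE hBS)
      have ha : f (W ∪ pairs z (B ∪ S)) ≤ f (pairs x (A ∪ B) ∪ pairs z (B ∪ S)) := by
        refine hmono _ _ (union_subset (union_subset ?_ ?_) ?_)
        · exact hcl hxE hA ((pairs_mono x subset_union_left).trans subset_union_left) hs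
        · refine (hV.pairs_subset_closure_union (hB.trans hUE) hxE hzE hycl).trans
            ((V 2).closure_subset_closure (union_subset_union ?_ ?_))
          exacts [pairs_mono x subset_union_right, pairs_mono z subset_union_left]
        · exact hcl hzE hBS subset_union_right hs
      have hb := hsubmod (pairs x (A ∪ B)) (pairs z (B ∪ S))
      have hc := hle x hxE _ hAB
      have hd := hle z hzE _ hBS
      omega
    have h3 := hlow (A ∪ B ∪ S) (union_subset hAB hS)
      (subset_union_right.trans subset_union_left)
    have h4 := hsubmod (W ∪ pairs z (A ∪ S)) (W ∪ pairs z (B ∪ S))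
    have h5 := hmono' (W ∪ pairs z S) ((W ∪ pairs z (A ∪ S)) ∩ (W ∪ pairs z (B ∪ S)))
      (subset_inter (union_subset_union_right _ (pairs_mono z subset_union_right))
        (union_subset_union_right _ (pairs_mono z subset_union_right)))
    have h6 : (W ∪ pairs z (A ∪ S)) ∪ (W ∪ pairs z (B ∪ S)) = W ∪ pairs z (A ∪ B ∪ S) := by
      simp only [pairs_union]
      ext
      simp only [mem_union]
      tauto
    rw [h6] at h4
    omega
  have hCD : C ∪ D ⊆ U := union_subset hC hD
  have hCDlow : r (A ∪ B) + r (C ∪ D) ≤ f (W ∪ pairs z (C ∪ D)) := by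
    have h1 := hlow U subset_rfl hB
    have h2 := hsubmod (W ∪ pairs z (C ∪ D)) (pairs z U)
    have h3 := hmono' (pairs z (C ∪ D)) ((W ∪ pairs z (C ∪ D)) ∩ pairs z U)
      (subset_inter subset_union_right (pairs_mono z hCD))
    have h4 := hmono' (W ∪ pairs z U) (W ∪ pairs z (C ∪ D) ∪ pairs z U)
      (union_subset_union_left _ subset_union_left)
    have h5 := hskewz ∅ (C ∪ D) (empty_subset _) hCD
    rw [show pairs x (∅ : Set α) = ∅ from image_empty _, empty_union] at h5
    have h6 := hle z hzE U subset_rfl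
    omega
  have hCb := hbound C hC
  have hDb := hbound D hD
  have h1 := hsubmod (W ∪ pairs z C) (W ∪ pairs z D)
  have h2 := hmono' W ((W ∪ pairs z C) ∩ (W ∪ pairs z D))
    (subset_inter subset_union_left subset_union_left)
  have h3 : r A + r B ≤ f W := hskewy A B hA hB
  have h4 : (W ∪ pairs z C) ∪ (W ∪ pairs z D) = W ∪ pairs z (C ∪ D) := by
    rw [pairs_union]
    ext
    simp only [mem_union]
    tauto
  rw [h4] at h1
  simp only [hr]
  norm_cast
  omega

end Ingleton

/-! ### Lindström's matroids -/

section Lindstrom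

variable {r : ℕ}

theorem lindstrom_indep_iff {I : Set (Fin 4 × Fin (r - 2))} : (lindstrom r).Indep I ↔
    I.ncard ≤ r ∧ ∀ H ∈ lindstromBlocks r, (I ∩ H).ncard ≤ r - 1 := by
  simp [lindstrom]

theorem uniform_indep_iff {k n : ℕ} {I : Set (Fin n)} : (uniform k n).Indep I ↔ I.ncard ≤ k := by
  simp [uniform]

theorem lindstromSum_indep_iff {I : Set ((Fin 4 × Fin (r - 2)) ⊕ Fin 3)} :
    (lindstromSum r).Indep I ↔
      (lindstrom r).Indep (Sum.inl ⁻¹' I) ∧ (uniform 2 3).Indep (Sum.inr ⁻¹' I) := by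
  simp [lindstromSum]

@[simp] theorem lindstromSum_ground : (lindstromSum r).E = univ := by
  simp [lindstromSum, lindstrom, uniform, range_inl_union_range_inr]

instance : (lindstromSum r).Finite := ⟨toFinite _⟩

/-- One of the four parts of the ground set of `M(r)`. -/
def lindstromPart (r : ℕ) (i : Fin 4) : Set (Fin 4 × Fin (r - 2)) := {x | x.1 = i}

theorem ncard_lindstromPart (r : ℕ) (i : Fin 4) : (lindstromPart r i).ncard = r - 2 := by
  have : lindstromPart r i = (fun x : Fin (r - 2) => (i, x)) '' univ := by
    ext x
    constructor
    · exact fun h => ⟨x.2, trivial, Prod.ext (Eq.symm h) rfl⟩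
    · rintro ⟨y, -, rfl⟩
      rfl
  rw [this, ncard_image_of_injective _ (fun a b h => congrArg Prod.snd h), ncard_univ]
  simp

theorem lindstromBlock_eq (i j : Fin 4) :
    lindstromBlock r i j = lindstromPart r i ∪ lindstromPart r j := rfl

theorem lindstrom_indep_part (hr : 4 ≤ r) (i : Fin 4) :
    (lindstrom r).Indep (lindstromPart r i) := by
  have h := ncard_lindstromPart r i
  refine lindstrom_indep_iff.2 ⟨by omega, fun H _ => ?_⟩
  have := ncard_le_ncard (inter_subset_left : lindstromPart r i ∩ H ⊆ _) (toFinite _)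
  omega

theorem ncard_insert_insert_part (hr : 4 ≤ r) {i : Fin 4} {u v : Fin 4 × Fin (r - 2)}
    (hu : u.1 ≠ i) (hv : v.1 ≠ i) (huv : u ≠ v) :
    (insert u (insert v (lindstromPart r i))).ncard = r := by
  rw [ncard_insert_of_notMem (by simp [huv, lindstromPart, hu]) (toFinite _),
    ncard_insert_of_notMem (by simp [lindstromPart, hv]) (toFinite _), ncard_lindstromPart]
  omega

theorem lindstrom_indep_of_not_subset {I : Set (Fin 4 × Fin (r - 2))} (hI : I.ncard ≤ r)
    (h : ∀ H ∈ lindstromBlocks r, ∃ e ∈ I, e ∉ H) : (lindstrom r).Indep I := by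
  refine lindstrom_indep_iff.2 ⟨hI, fun H hH => ?_⟩
  obtain ⟨e, he, heH⟩ := h H hH
  have := ncard_lt_ncard (s := I ∩ H) (t := I)
    ⟨inter_subset_left, fun hs => heH (hs he).2⟩ (toFinite _)
  omega

/-- The five blocks violate the Ingleton inequality by one: its left side is at least
`2 (r - 2) + 3 r` and its right side at most `5 (r - 1)`. -/
theorem not_hasSymmetricPower_two_lindstromSum (hr : 4 ≤ r) :
    ¬ (lindstromSum r).HasSymmetricPower 2 := by
  intro h
  have hfin : (lindstromSum r).RankFinite := inferInstance
  have hinl : ∀ I : Set (Fin 4 × Fin (r - 2)), (lindstrom r).Indep I →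
      (lindstromSum r).Indep (Sum.inl '' I) := fun I hI => by
    rw [lindstromSum_indep_iff, preimage_image_eq _ Sum.inl_injective]
    refine ⟨hI, ?_⟩
    convert (uniform 2 3).empty_indep
    ext
    simp
  have hpair : ∀ I ⊆ range (Sum.inl : _ → (Fin 4 × Fin (r - 2)) ⊕ Fin 3),
      (lindstromSum r).Indep I → ∀ a b : Fin 3,
      (lindstromSum r).Indep (I ∪ {Sum.inr a, Sum.inr b}) := fun I hI hIi a b => by
    rw [lindstromSum_indep_iff] at hIi ⊢
    constructor
    · convert hIi.1 using 1
      ext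
      simp
    · rw [uniform_indep_iff]
      refine (ncard_le_ncard (t := {a, b}) ?_ (toFinite _)).trans
        ((ncard_insert_le a {b}).trans (by simp))
      rintro c (hc | hc)
      · obtain ⟨d, hd⟩ := hI hc
        exact absurd hd (by simp)
      · simpa using hc
  have hline : ∀ a b c : Fin 3, a ≠ b → a ≠ c → b ≠ c →
      (Sum.inr a : (Fin 4 × Fin (r - 2)) ⊕ Fin 3) ∈
        (lindstromSum r).closure {Sum.inr b, Sum.inr c} := by
    intro a b c hab hac hbc
    have hI := hpair ∅ (empty_subset _) (empty_indep _) b c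
    rw [empty_union] at hI
    rw [hI.mem_closure_iff]
    left
    refine ⟨fun hcon => ?_, by simp⟩
    rw [lindstromSum_indep_iff, uniform_indep_iff] at hcon
    have : ((Sum.inr : Fin 3 → (Fin 4 × Fin (r - 2)) ⊕ Fin 3) ⁻¹'
        insert (Sum.inr a) {Sum.inr b, Sum.inr c}) =
      (({a, b, c} : Finset (Fin 3)) : Set (Fin 3)) := by
      ext
      simp
    rw [this, ncard_coe_finset, Finset.card_eq_three.2 ⟨a, b, c, hab, hac, hbc, rfl⟩] at hcon
    omega
  have hlow : ∀ (S I : Set (Fin 4 × Fin (r - 2))), (lindstrom r).Indep I → I ⊆ S →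
      (I.ncard : ℕ∞) ≤ (lindstromSum r).eRk (Sum.inl '' S) := by
    intro S I hI hIS
    have := (hinl I hI).encard_le_eRk_of_subset (image_mono hIS)
    rwa [Sum.inl_injective.encard_image, ← (toFinite I).cast_ncard_eq] at this
  have hup : ∀ i j : Fin 4, lindstromBlock r i j ∈ lindstromBlocks r →
      (lindstromSum r).eRk (Sum.inl '' lindstromPart r i ∪ Sum.inl '' lindstromPart r j) ≤
        (r - 1 : ℕ) := by
    intro i j hij
    rw [← image_union, ← lindstromBlock_eq, eRk_le_iff]
    intro I hI hIi
    obtain ⟨I, hIb, rfl⟩ := subset_image_iff.1 hI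
    rw [lindstromSum_indep_iff, preimage_image_eq _ Sum.inl_injective, lindstrom_indep_iff] at hIi
    have := hIi.1.2 _ hij
    rw [inter_eq_left.2 hIb] at this
    rw [Sum.inl_injective.encard_image, ← (toFinite I).cast_ncard_eq]
    exact_mod_cast this
  obtain ⟨V, hV, hind⟩ := h.exists_isGradedPower (by omega)
    (indep_singleton.1 ((hpair ∅ (empty_subset _) (empty_indep _) 0 0).subset
      (singleton_subset_iff.2 (Or.inr (mem_insert _ _)))))
  have hing := hV.ingleton hind (x := Sum.inr 0) (y := Sum.inr 1) (z := Sum.inr 2)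
    (U := range Sum.inl) (by simp) (by simp) (hline 0 1 2 (by decide) (by decide) (by decide))
    (hline 1 0 2 (by decide) (by decide) (by decide)) (by simp) (by simp) (by simp) (by simp)
    (fun I hI h => hpair I hI h 0 1) (fun I hI h => hpair I hI h 0 2)
    (image_subset_range _ (lindstromPart r 0)) (image_subset_range _ (lindstromPart r 1))
    (image_subset_range _ (lindstromPart r 2)) (image_subset_range _ (lindstromPart r 3))
  have hAB := hup 0 1 (by simp [lindstromBlocks])
  have hAC := hup 0 2 (by simp [lindstromBlocks])
  have hAD := hup 0 3 (by simp [lindstromBlocks])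
  have hBC := hup 1 2 (by simp [lindstromBlocks])
  have hBD := hup 1 3 (by simp [lindstromBlocks])
  have hA := hlow _ _ (lindstrom_indep_part hr 0) subset_rfl
  have hB := hlow _ _ (lindstrom_indep_part hr 1) subset_rfl
  rw [ncard_lindstromPart] at hA hB
  let o : Fin (r - 2) := ⟨0, by omega⟩
  let o' : Fin (r - 2) := ⟨1, by omega⟩
  have hoo : o ≠ o' := by simp [o, o']
  have hrank : ∀ (i : Fin 4) (u v : Fin 4 × Fin (r - 2)) (S : Set (Fin 4 × Fin (r - 2))),
      u.1 ≠ i → v.1 ≠ i → u ≠ v →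
      (∀ H ∈ lindstromBlocks r, u ∉ H ∨ v ∉ H ∨ (i, o) ∉ H) →
      insert u (insert v (lindstromPart r i)) ⊆ S →
      (r : ℕ∞) ≤ (lindstromSum r).eRk (Sum.inl '' S) := by
    intro i u v S hu hv huv hH hS
    have hn := ncard_insert_insert_part hr hu hv huv
    have := hlow S _ (lindstrom_indep_of_not_subset hn.le fun H hHm => ?_) hS
    · rwa [hn] at this
    · rcases hH H hHm with h | h | h
      · exact ⟨u, by simp, h⟩
      · exact ⟨v, by simp, h⟩
      · exact ⟨(i, o), by simp [lindstromPart], h⟩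
  have hABC := hrank 0 (1, o) (2, o) (lindstromPart r 0 ∪ lindstromPart r 1 ∪ lindstromPart r 2)
    (by simp) (by simp) (by simp) (by simp [lindstromBlocks, lindstromBlock])
    (by
      refine insert_subset (by simp [lindstromPart]) (insert_subset (by simp [lindstromPart]) ?_)
      exact subset_union_left.trans subset_union_left)
  have hABD := hrank 0 (1, o) (3, o) (lindstromPart r 0 ∪ lindstromPart r 1 ∪ lindstromPart r 3)
    (by simp) (by simp) (by simp) (by simp [lindstromBlocks, lindstromBlock])
    (by
      refine insert_subset (by simp [lindstromPart]) (insert_subset (by simp [lindstromPart]) ?_)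
      exact subset_union_left.trans subset_union_left)
  have hCD := hrank 2 (3, o) (3, o') (lindstromPart r 2 ∪ lindstromPart r 3)
    (by simp) (by simp) (by simp [hoo]) (by simp [lindstromBlocks, lindstromBlock])
    (by
      refine insert_subset (by simp [lindstromPart]) (insert_subset (by simp [lindstromPart]) ?_)
      exact subset_union_left)
  rw [image_union, image_union] at hABC hABD
  rw [image_union] at hCD
  have hchain := (add_le_add (add_le_add (add_le_add (add_le_add hA hB) hABC) hABD) hCD).trans
    (hing.trans (add_le_add (add_le_add (add_le_add (add_le_add hAB hAC) hAD) hBC) hBD))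
  norm_cast at hchain
  omega

end Lindstrom

/-! ### Representable matroids -/

section Representable

variable {α β W : Type*} [AddCommGroup W] [Module ℚ W] {M N : Matroid α} {d : ℕ}

/-- The matroid of linear independence of a family of vectors on a finite ground set. -/
def ofVectors (v : α → W) {E : Set α} (hE : E.Finite) : Matroid α :=
  (IndepMatroid.ofFinite hE (fun I => I ⊆ E ∧ LinearIndepOn ℚ v I)
    ⟨empty_subset _, linearIndepOn_empty ℚ v⟩
    (fun _ _ hJ hIJ => ⟨hIJ.trans hJ.1, hJ.2.mono hIJ⟩)
    (by
      intro I J hI hJ hIJ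
      by_contra! hcon
      have hspan : Submodule.span ℚ (v '' J) ≤ Submodule.span ℚ (v '' I) := by
        rw [Submodule.span_le]
        rintro _ ⟨e, he, rfl⟩
        refine (hI.2.mem_span_iff).2 fun hins => ?_
        by_contra heI
        exact hcon e he heI (insert_subset (hJ.1 he) hI.1) hins
      have h := OrderHom.mono (β := ℕ∞) Cardinal.toENat (Submodule.rank_mono hspan)
      change Cardinal.toENat _ ≤ Cardinal.toENat _ at h
      rw [toENat_rank_span_set hI.2, toENat_rank_span_set hJ.2,
        ← (hE.subset hI.1).cast_ncard_eq, ← (hE.subset hJ.1).cast_ncard_eq] at h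
      have : J.ncard ≤ I.ncard := by exact_mod_cast h
      omega)
    (fun _ hI => hI.1)).matroid

theorem ofVectors_indep_iff {v : α → W} {E : Set α} {hE : E.Finite} {I : Set α} :
    (ofVectors v hE).Indep I ↔ I ⊆ E ∧ LinearIndepOn ℚ v I := by
  simp [ofVectors]

theorem exists_linearMap_of_linearIndepOn {W' : Type*} [AddCommGroup W'] [Module ℚ W']
    {v : α → W} {B : Set α} (hB : LinearIndepOn ℚ v B) (f : α → W') :
    ∃ L : W →ₗ[ℚ] W', ∀ b ∈ B, L (v b) = f b := by
  let b := Module.Basis.span hB.linearIndependent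
  obtain ⟨L, hL⟩ := LinearMap.exists_extend (b.constr ℚ fun i : B => f i)
  refine ⟨L, fun i hi => ?_⟩
  have h1 := b.constr_basis ℚ (fun i : B => f i) ⟨i, hi⟩
  rw [← hL] at h1
  have h2 : ((b ⟨i, hi⟩ : Submodule.span ℚ _) : W) = v i :=
    congrArg Subtype.val (Module.Basis.span_apply hB.linearIndependent ⟨i, hi⟩)
  rw [LinearMap.comp_apply, Submodule.subtype_apply, h2] at h1
  exact h1

/-- A matroid that is represented over `ℚ` by a family of vectors. -/
def IsRepresentable (M : Matroid α) : Prop :=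
  ∃ (W : Type) (_ : AddCommGroup W) (_ : Module ℚ W) (v : α → W),
    ∀ I ⊆ M.E, (M.Indep I ↔ LinearIndepOn ℚ v I)

theorem IsRepresentable.of_isMinor (h : M.IsRepresentable) (hNM : N ≤m M) :
    N.IsRepresentable := by
  obtain ⟨W, _, _, v, hv⟩ := h
  obtain ⟨C, D, hC, -, -, rfl⟩ := hNM.exists_eq_contract_delete_disjoint
  obtain ⟨I, hI⟩ := M.exists_isBasis C
  refine ⟨W ⧸ Submodule.span ℚ (v '' I), inferInstance, inferInstance,
    (Submodule.span ℚ (v '' I)).mkQ ∘ v, fun X hX => ?_⟩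
  have hXE : X ⊆ M.E := fun e he => (hX he).1.1
  have hXC : Disjoint C X := disjoint_left.2 fun e heC he => (hX he).1.2 heC
  have hXD : Disjoint X D := disjoint_left.2 fun e he heD => (hX he).2 heD
  rw [delete_indep_iff, and_iff_left hXD, hI.contract_indep_iff, and_iff_left hXC, union_comm,
    hv _ (union_subset (hI.subset.trans hC) hXE),
    linearIndepOn_union_iff_quotient (hXC.mono_left hI.subset),
    and_iff_right ((hv I (hI.subset.trans hC)).1 hI.indep)]

theorem IsRepresentable.of_isIsomorphic {N : Matroid β} (h : N.IsRepresentable)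
    (hMN : M.IsIsomorphic N) : M.IsRepresentable := by
  classical
  obtain ⟨W, _, _, v, hv⟩ := h
  obtain ⟨f, hf⟩ := hMN
  refine ⟨W, inferInstance, inferInstance, fun e => if h : e ∈ M.E then v (f ⟨e, h⟩) else 0,
    fun I hI => ?_⟩
  obtain ⟨I, rfl⟩ : ∃ I₀ : Set M.E, I = Subtype.val '' I₀ :=
    ⟨Subtype.val ⁻¹' I, by rw [Subtype.image_preimage_coe, inter_eq_right.2 hI]⟩
  have hcomp : (fun e => if h : e ∈ M.E then v (f ⟨e, h⟩) else 0) ∘ (Subtype.val : M.E → α) =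
      v ∘ fun e => (f e : β) := by
    ext e
    simp
  have hinj : Function.Injective fun e => (f e : β) := Subtype.val_injective.comp f.injective
  rw [hf, hv _ (by rintro _ ⟨e, -, rfl⟩; exact e.2), image_image]
  constructor
  · intro h
    refine LinearIndepOn.image_of_comp _ _ ?_
    rw [hcomp]
    exact h.comp_of_image hinj.injOn
  · intro h
    refine LinearIndepOn.image_of_comp _ _ ?_
    rw [← hcomp]
    exact h.comp_of_image Subtype.val_injective.injOn

/-- A representable matroid has symmetric powers. Choose coordinates in which a base becomes a set
of variables of a polynomial ring; the products of the linear forms assigned to the elements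
of a tuple represent the powers. Multiplication by a nonzero form is injective, and the products of
elements of the base are distinct monomials. -/
theorem IsRepresentable.hasSymmetricPower (h : M.IsRepresentable) (hfin : M.Finite)
    (hd : 1 ≤ d) : M.HasSymmetricPower d := by
  classical
  obtain ⟨W, _, _, v, hv⟩ := h
  obtain ⟨B, hB⟩ := M.exists_isBase
  have hBE := hB.subset_ground
  have hBv := (hv B hBE).1 hB.indep
  obtain ⟨L, hL⟩ := exists_linearMap_of_linearIndepOn hBv
    (fun b => (MvPolynomial.X b : MvPolynomial α ℚ))
  have hmon : LinearIndependent ℚ (fun m : α →₀ ℕ => MvPolynomial.monomial m (1 : ℚ)) := by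
    have := (MvPolynomial.basisMonomials α ℚ).linearIndependent
    rwa [MvPolynomial.coe_basisMonomials] at this
  have hLB : LinearIndepOn ℚ (L ∘ v) B := by
    have h1 : LinearIndependent ℚ (fun b : B => (MvPolynomial.X (b : α) : MvPolynomial α ℚ)) :=
      hmon.comp (fun b : B => Finsupp.single (b : α) 1) fun a b hab =>
        Subtype.ext (Finsupp.single_left_injective one_ne_zero hab)
    have h2 : (fun b : B => (L ∘ v) b) = fun b : B => MvPolynomial.X (b : α) :=
      funext fun b => hL b b.2
    rw [LinearIndepOn, h2]
    exact h1
  have hLinj : InjOn L (Submodule.span ℚ (v '' M.E)) := by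
    have h1 : Submodule.span ℚ (v '' M.E) ≤ Submodule.span ℚ (v '' B) := by
      rw [Submodule.span_le]
      rintro _ ⟨e, he, rfl⟩
      refine (hBv.mem_span_iff).2 fun hins => ?_
      exact hB.mem_of_insert_indep ((hv _ (insert_subset he hBE)).2 hins)
    have h2 : Disjoint (Submodule.span ℚ (v '' B)) (LinearMap.ker L) := by
      rw [image_eq_range]
      exact Submodule.range_ker_disjoint hLB
    exact (LinearMap.injOn_of_disjoint_ker (fun _ h => h) h2).mono h1
  -- the linear form of an element
  let φ : α → MvPolynomial α ℚ := L ∘ v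
  have hφ : ∀ I ⊆ M.E, (M.Indep I ↔ LinearIndepOn ℚ φ I) := fun I hI => by
    rw [hv I hI]
    exact (L.linearIndepOn_iff_of_injOn
      (hLinj.mono (Submodule.span_mono (image_mono hI)))).symm
  have hφ0 : ∀ e ∈ M.E, (M.IsNonloop e ↔ φ e ≠ 0) := fun e he => by
    rw [← indep_singleton, hφ _ (singleton_subset_iff.2 he), linearIndepOn_singleton_iff]
  let ψ : Multiset α → MvPolynomial α ℚ := fun s => (s.map φ).prod
  have hψ : ∀ b s, ψ (b ::ₘ s) = φ b * ψ s := fun b s => by simp [ψ]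
  have hE := hfin.ground_finite
  have hgr : M.IsGradedPower d (fun i => ofVectors ψ (symSet_finite hE i)) := by
    constructor
    · exact fun i _ => rfl
    · intro _ X hX
      rw [ofVectors_indep_iff, and_iff_right (by rw [symSet_one]; exact image_mono hX), hφ X hX]
      have hc : ψ ∘ (fun e => ({e} : Multiset α)) = φ := by
        ext1 e
        simp [ψ]
      constructor
      · intro h
        have := h.comp_of_image (s := X) fun _ _ _ _ h => Multiset.singleton_inj.1 h
        rwa [hc] at this
      · intro h
        refine LinearIndepOn.image_of_comp _ _ ?_
        rwa [hc]
    · intro i _ b hb X hX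
      have hb0 := (hφ0 b hb.mem_ground).1 hb
      have hc : ψ ∘ (fun s => b ::ₘ s) = LinearMap.mulLeft ℚ (φ b) ∘ ψ := by
        ext1 s
        exact hψ b s
      rw [ofVectors_indep_iff, ofVectors_indep_iff, and_iff_right hX, and_iff_right (by
        rintro _ ⟨s, hs, rfl⟩
        exact cons_mem_symSet hb.mem_ground (hX hs))]
      have hiff := (LinearMap.mulLeft ℚ (φ b)).linearIndepOn_iff_of_injOn (v := ψ) (s := X)
        (mul_right_injective₀ hb0).injOn
      rw [← hiff, ← hc]
      exact ⟨fun h => h.comp_of_image fun _ _ _ _ h => (Multiset.cons_inj_right b).1 h,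
        fun h => h.image_of_comp _ _⟩
    · rintro i - s hs ⟨e, he, hel⟩
      refine (singleton_not_indep (by exact hs)).1 fun hcon => ?_
      rw [ofVectors_indep_iff, linearIndepOn_singleton_iff] at hcon
      obtain ⟨t, rfl⟩ := Multiset.exists_cons_of_mem he
      refine hcon.2 ?_
      rw [hψ, not_not.1 fun h => ((hφ0 e hel.mem_ground).2 h).not_isLoop hel, zero_mul]
  refine hgr.hasSymmetricPower hd hB (hE.subset hBE) ?_
  rw [ofVectors_indep_iff, and_iff_right (symSet_mono hBE d)]
  have hψB : ∀ s : Multiset α, (∀ e ∈ s, e ∈ B) →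
      ψ s = MvPolynomial.monomial (Multiset.toFinsupp s) 1 := by
    intro s
    induction s using Multiset.induction with
    | empty => intro _; simp [ψ]
    | cons a s ih =>
      intro hs
      rw [hψ, ih fun e he => hs e (Multiset.mem_cons_of_mem he), ← Multiset.singleton_add,
        map_add, Multiset.toFinsupp_singleton]
      change L (v a) * _ = _
      rw [hL a (hs a (Multiset.mem_cons_self _ _)), MvPolynomial.X, MvPolynomial.monomial_mul,
        one_mul]
  refine (linearIndepOn_congr (w := fun s => MvPolynomial.monomial (Multiset.toFinsupp s) 1)
    fun s hs => hψB s hs.2).2 ?_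
  exact (hmon.comp _ Multiset.toFinsupp.injective).linearIndepOn _

/-- Independence of a family of vectors of a direct sum, each of which lies in one summand. -/
theorem linearIndepOn_sumElim_iff {W' : Type*} [AddCommGroup W'] [Module ℚ W'] {v : α → W}
    {w : β → W'} {I : Set (α ⊕ β)} :
    LinearIndepOn ℚ (Sum.elim (LinearMap.inl ℚ W W' ∘ v) (LinearMap.inr ℚ W W' ∘ w)) I ↔
      LinearIndepOn ℚ v (Sum.inl ⁻¹' I) ∧ LinearIndepOn ℚ w (Sum.inr ⁻¹' I) := by
  set u := Sum.elim (LinearMap.inl ℚ W W' ∘ v) (LinearMap.inr ℚ W W' ∘ w) with hu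
  have hl : LinearIndepOn ℚ u (Sum.inl '' (Sum.inl ⁻¹' I)) ↔
      LinearIndepOn ℚ v (Sum.inl ⁻¹' I) := by
    rw [← (LinearMap.inl ℚ W W').linearIndepOn_iff_of_injOn (v := v)
      LinearMap.inl_injective.injOn]
    exact ⟨fun h => h.comp_of_image Sum.inl_injective.injOn,
      fun h => LinearIndepOn.image_of_comp _ u h⟩
  have hr : LinearIndepOn ℚ u (Sum.inr '' (Sum.inr ⁻¹' I)) ↔
      LinearIndepOn ℚ w (Sum.inr ⁻¹' I) := by
    rw [← (LinearMap.inr ℚ W W').linearIndepOn_iff_of_injOn (v := w)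
      LinearMap.inr_injective.injOn]
    exact ⟨fun h => h.comp_of_image Sum.inr_injective.injOn,
      fun h => LinearIndepOn.image_of_comp _ u h⟩
  have hI : I = Sum.inl '' (Sum.inl ⁻¹' I) ∪ Sum.inr '' (Sum.inr ⁻¹' I) :=
    (image_preimage_inl_union_image_preimage_inr I).symm
  rw [← hl, ← hr]
  conv_lhs => rw [hI]
  rw [linearIndepOn_union_iff, ← and_assoc, and_iff_left]
  · refine (LinearMap.disjoint_inl_inr (R := ℚ) (M := W) (M₂ := W')).mono ?_ ?_
    · rw [Submodule.span_le]
      rintro _ ⟨_, ⟨a, -, rfl⟩, rfl⟩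
      exact ⟨v a, rfl⟩
    · rw [Submodule.span_le]
      rintro _ ⟨_, ⟨a, -, rfl⟩, rfl⟩
      exact ⟨w a, rfl⟩
  · rw [disjoint_left]
    rintro _ ⟨a, -, rfl⟩ ⟨b, -, hb⟩
    exact absurd hb (by simp)

/-! ### Generic vectors in prescribed subspaces -/

/-- If `u` is independent on a finite set, then so is `w + t u` for all but finitely many `t`: in
suitable coordinates it is given there by a matrix `A + t`. -/
theorem finite_setOf_not_linearIndepOn_add_smul {I : Set α} (hI : I.Finite) {u : α → W}
    (hu : LinearIndepOn ℚ u I) (w : α → W) :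
    {t : ℚ | ¬ LinearIndepOn ℚ (fun i => w i + t • u i) I}.Finite := by
  classical
  have := hI.fintype
  obtain ⟨L, hL⟩ := exists_linearMap_of_linearIndepOn hu
    (fun i => if h : i ∈ I then (Pi.single ⟨i, h⟩ 1 : I → ℚ) else 0)
  let A : Matrix I I ℚ := Matrix.of fun i => L (w i)
  refine ((-A).charpoly.roots.toFinset.finite_toSet).subset fun t ht => ?_
  rw [Finset.mem_coe, Multiset.mem_toFinset,
    Polynomial.mem_roots (Matrix.charpoly_monic _).ne_zero, Polynomial.IsRoot,
    Matrix.eval_charpoly]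
  by_contra hdet
  refine ht (LinearIndependent.of_comp L ?_)
  have hrow : (L ∘ fun i : I => w i + t • u i) = (Matrix.scalar I t - -A).row := by
    ext i j
    simp only [Function.comp_apply, map_add, map_smul, hL i i.2, dif_pos i.2, Pi.add_apply,
      Pi.smul_apply, smul_eq_mul, Matrix.row, Matrix.sub_apply, Matrix.scalar_apply,
      Matrix.diagonal_apply, Matrix.neg_apply, A, Matrix.of_apply, sub_neg_eq_add]
    rw [add_comm]
    simp [Pi.single_apply, eq_comm]
  rw [hrow]
  exact Matrix.linearIndependent_rows_of_det_ne_zero hdet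

/-- Vectors in given subspaces can be chosen so that every set of indices is independent for which
some choice of vectors is. -/
theorem exists_generic [Finite α] (U : α → Submodule ℚ W) :
    ∃ v : α → W, (∀ i, v i ∈ U i) ∧ ∀ I : Set α,
      (∃ u : α → W, (∀ i ∈ I, u i ∈ U i) ∧ LinearIndepOn ℚ u I) → LinearIndepOn ℚ v I := by
  suffices h : ∀ 𝓘 : Set (Set α), 𝓘.Finite →
      (∀ I ∈ 𝓘, ∃ u : α → W, (∀ i ∈ I, u i ∈ U i) ∧ LinearIndepOn ℚ u I) →
      ∃ v : α → W, (∀ i, v i ∈ U i) ∧ ∀ I ∈ 𝓘, LinearIndepOn ℚ v I by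
    obtain ⟨v, hvU, hv⟩ := h {I | ∃ u : α → W, (∀ i ∈ I, u i ∈ U i) ∧ LinearIndepOn ℚ u I}
      (toFinite _) fun I hI => hI
    exact ⟨v, hvU, fun I hI => hv I hI⟩
  intro 𝓘 h𝓘
  induction 𝓘, h𝓘 using Set.Finite.induction_on with
  | empty => exact fun _ => ⟨0, fun i => zero_mem _, by simp⟩
  | @insert I₀ 𝓘 _ h𝓘 ih =>
    classical
    intro h
    obtain ⟨v, hvU, hv⟩ := ih fun I hI => h I (mem_insert_of_mem _ hI)
    obtain ⟨u, huU, hu⟩ := h I₀ (mem_insert _ _)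
    let u' : α → W := fun i => if i ∈ I₀ then u i else 0
    have hu' : LinearIndepOn ℚ u' I₀ := hu.congr fun i hi => (if_pos hi).symm
    have hu'U : ∀ i, u' i ∈ U i := fun i => by
      by_cases hi : i ∈ I₀
      · simpa [u', hi] using huU i hi
      · simp [u', hi]
    -- the bad parameters for `u' + t v = t (v + t⁻¹ u')`
    have h1 : ({0} ∪ (⋃ I ∈ 𝓘, {t : ℚ | ¬ LinearIndepOn ℚ (fun i => u' i + t • v i) I}) ∪
        (fun t => t⁻¹) ⁻¹' {t : ℚ | ¬ LinearIndepOn ℚ (fun i => v i + t • u' i) I₀}).Finite := by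
      refine ((finite_singleton 0).union (h𝓘.biUnion fun I hI => ?_)).union
        (Finite.preimage inv_injective.injOn ?_)
      · exact finite_setOf_not_linearIndepOn_add_smul (toFinite I) (hv I hI) u'
      · exact finite_setOf_not_linearIndepOn_add_smul (toFinite I₀) hu' v
    obtain ⟨t, ht⟩ := h1.exists_notMem
    simp only [mem_union, mem_singleton_iff, mem_iUnion, mem_preimage, not_or, not_exists,
      mem_ofPred_eq, not_not] at ht
    obtain ⟨⟨ht0, ht1⟩, ht2⟩ := ht
    refine ⟨fun i => u' i + t • v i, fun i => add_mem (hu'U i) (Submodule.smul_mem _ _ (hvU i)),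
      fun I hI => ?_⟩
    rcases mem_insert_iff.1 hI with rfl | hI
    · have h2 := ht2.map_injOn (LinearMap.lsmul ℚ W t)
        ((smul_right_injective W ht0).injOn)
      convert h2 using 1
      ext1 i
      simp [smul_smul, mul_inv_cancel₀ ht0, add_comm]
    · exact ht1 I hI

/-- Vectors in general position represent a uniform matroid. -/
theorem exists_linearIndepOn_iff_ncard_le (α : Type*) [Finite α] (k : ℕ) :
    ∃ v : α → Fin k → ℚ, ∀ I : Set α, LinearIndepOn ℚ v I ↔ I.ncard ≤ k := by
  obtain ⟨v, -, hv⟩ := exists_generic (W := Fin k → ℚ) fun _ : α => ⊤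
  refine ⟨v, fun I => ⟨fun h => ?_, fun h => hv I ?_⟩⟩
  · have := h.encard_le_toENat_rank
    simp only [rank_fun', Fintype.card_fin, map_natCast] at this
    rw [← (toFinite I).cast_ncard_eq] at this
    exact_mod_cast this
  · have := (toFinite I).fintype
    obtain ⟨f⟩ : Nonempty (I ↪ Fin k) := by
      refine Function.Embedding.nonempty_of_card_le ?_
      rwa [← Nat.card_eq_fintype_card, Nat.card_coe_set_eq, Fintype.card_fin]
    classical
    refine ⟨fun i => if h : i ∈ I then Pi.single (f ⟨i, h⟩) 1 else 0, fun _ _ => trivial, ?_⟩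
    have hf : (fun i : I => if h : (i : α) ∈ I then
        (Pi.single (f ⟨i, h⟩) 1 : Fin k → ℚ) else 0) = Pi.basisFun ℚ (Fin k) ∘ f := by
      ext1 i
      simp
    rw [LinearIndepOn, hf]
    exact (Pi.basisFun ℚ (Fin k)).linearIndependent.comp f f.injective

end Representable

/-! ### Representable minors of Lindström's matroids -/

section LindstromMinors

variable {r : ℕ}

/-- Two different parts of the ground set of `M(r)` are partners if their union is a block, that
is, unless they are `C` and `D`. -/
def IsPartner (p q : Fin 4) : Prop := p ≠ q ∧ ¬ (p = 2 ∧ q = 3) ∧ ¬ (p = 3 ∧ q = 2)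

theorem lindstromBlock_comm (i j : Fin 4) : lindstromBlock r i j = lindstromBlock r j i := by
  ext x
  exact or_comm

theorem mem_lindstromBlocks_of_isPartner {p q : Fin 4} (h : IsPartner p q) :
    lindstromBlock r p q ∈ lindstromBlocks r := by
  have key : ∀ p q : Fin 4, (p ≠ q ∧ ¬ (p = 2 ∧ q = 3) ∧ ¬ (p = 3 ∧ q = 2)) →
      (p = 0 ∧ q = 1 ∨ p = 0 ∧ q = 2 ∨ p = 0 ∧ q = 3 ∨ p = 1 ∧ q = 2 ∨ p = 1 ∧ q = 3) ∨
      (q = 0 ∧ p = 1 ∨ q = 0 ∧ p = 2 ∨ q = 0 ∧ p = 3 ∨ q = 1 ∧ p = 2 ∨ q = 1 ∧ p = 3) := by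
    decide
  rcases key p q h with h | h
  · rcases h with ⟨rfl, rfl⟩ | ⟨rfl, rfl⟩ | ⟨rfl, rfl⟩ | ⟨rfl, rfl⟩ | ⟨rfl, rfl⟩ <;>
      simp [lindstromBlocks]
  · rw [lindstromBlock_comm]
    rcases h with ⟨rfl, rfl⟩ | ⟨rfl, rfl⟩ | ⟨rfl, rfl⟩ | ⟨rfl, rfl⟩ | ⟨rfl, rfl⟩ <;>
      simp [lindstromBlocks]

theorem exists_isPartner_of_mem {H : Set (Fin 4 × Fin (r - 2))} (hH : H ∈ lindstromBlocks r)
    {a : Fin 4 × Fin (r - 2)} (ha : a ∈ H) :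
    ∃ q, IsPartner a.1 q ∧ H = lindstromBlock r a.1 q := by
  have key : ∀ i j, H = lindstromBlock r i j → IsPartner i j → IsPartner j i →
      ∃ q, IsPartner a.1 q ∧ H = lindstromBlock r a.1 q := by
    rintro i j rfl hij hji
    rcases ha with h | h
    · exact ⟨j, h ▸ hij, by rw [h]⟩
    · exact ⟨i, h ▸ hji, by rw [h, lindstromBlock_comm]⟩
  simp only [lindstromBlocks, mem_insert_iff, mem_singleton_iff] at hH
  rcases hH with h | h | h | h | h <;>
    exact key _ _ h (by unfold IsPartner; decide) (by unfold IsPartner; decide)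

theorem lindstrom_indep_of_ncard_lt {I : Set (Fin 4 × Fin (r - 2))} (hI : I.ncard < r) :
    (lindstrom r).Indep I := by
  refine lindstrom_indep_iff.2 ⟨hI.le, fun H _ => ?_⟩
  have := ncard_le_ncard (inter_subset_left : I ∩ H ⊆ I) (toFinite _)
  omega

theorem ncard_of_isBase_lindstrom (hr : 4 ≤ r) {J : Set (Fin 4 × Fin (r - 2))}
    (hJ : (lindstrom r).IsBase J) : J.ncard = r := by
  let o : Fin (r - 2) := ⟨0, by omega⟩
  have hn := ncard_insert_insert_part hr (i := 0) (u := (1, o)) (v := (2, o)) (by simp) (by simp)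
    (by simp)
  have hI : (lindstrom r).Indep (insert (1, o) (insert (2, o) (lindstromPart r 0))) := by
    refine lindstrom_indep_of_not_subset hn.le ?_
    have h0 : ((0, o) : Fin 4 × Fin (r - 2)) ∈
        insert (1, o) (insert (2, o) (lindstromPart r 0)) := by simp [lindstromPart]
    simp only [lindstromBlocks, mem_insert_iff, mem_singleton_iff, forall_eq_or_imp, forall_eq]
    exact ⟨⟨(2, o), by simp, by simp [lindstromBlock]⟩, ⟨(1, o), by simp, by simp [lindstromBlock]⟩,
      ⟨(1, o), by simp, by simp [lindstromBlock]⟩, ⟨(0, o), h0, by simp [lindstromBlock]⟩,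
      ⟨(0, o), h0, by simp [lindstromBlock]⟩⟩
  obtain ⟨J', hJ', hIJ'⟩ := hI.exists_isBase_superset
  have h1 := hJ.encard_eq_encard_of_isBase hJ'
  have h2 : J.ncard = J'.ncard := by rw [ncard_def, ncard_def, h1]
  have h3 := ncard_le_ncard hIJ' (toFinite _)
  have h4 := (lindstrom_indep_iff.1 hJ.indep).1
  omega

/-- The direction of slope `q` in the plane. -/
def slope (q : Fin 4) : ℚ × ℚ := (1, ((q : ℕ) : ℚ))

open Classical in
/-- Directions that are allowed for the elements of the part `q` when `M(r) ／ a` with `a` in the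
part `p` is represented in the sum of a plane and a space of dimension `r - 3`: none for `p`
itself, a line of slope `q` for a partner of `p`, and the whole plane otherwise. -/
noncomputable def directions (p q : Fin 4) : Submodule ℚ (ℚ × ℚ) :=
  if q = p then ⊥ else if IsPartner p q then Submodule.span ℚ {slope q} else ⊤

theorem slope_mem_directions {p q : Fin 4} (h : q ≠ p) :
    slope q ∈ directions p q := by
  unfold directions
  rw [if_neg h]
  split_ifs
  · exact Submodule.mem_span_singleton_self _
  · trivial

/-- For a base `J` and an element `a`, two elements of `J` other than `a` have
independent directions. -/
theorem exists_independent_directions (hr : 4 ≤ r) {J : Set (Fin 4 × Fin (r - 2))}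
    (hJ : (lindstrom r).IsBase J) (a : Fin 4 × Fin (r - 2)) :
    ∃ i ∈ J, ∃ j ∈ J, i ≠ a ∧ j ≠ a ∧ i ≠ j ∧ ∃ y : Fin 4 × Fin (r - 2) → ℚ × ℚ,
      y i ∈ directions a.1 i.1 ∧ y j ∈ directions a.1 j.1 ∧ LinearIndepOn ℚ y {i, j} := by
  classical
  have hJr := ncard_of_isBase_lindstrom hr hJ
  by_cases hex : ∃ x ∈ J, IsPartner a.1 x.1
  · obtain ⟨i, hi, hai⟩ := hex
    have hne := hai.1
    -- `J` does not lie in the block formed by the parts of `a` and `i`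
    obtain ⟨j, hj, hjb⟩ : ∃ j ∈ J, j ∉ lindstromBlock r a.1 i.1 := by
      by_contra! hcon
      have := (lindstrom_indep_iff.1 hJ.indep).2 _ (mem_lindstromBlocks_of_isPartner hai)
      rw [inter_eq_left.2 hcon] at this
      omega
    have hja : j.1 ≠ a.1 := fun h => hjb (Or.inl h)
    have hji : j.1 ≠ i.1 := fun h => hjb (Or.inr h)
    refine ⟨i, hi, j, hj, fun h => hne (by rw [h]), fun h => hja (by rw [h]),
      fun h => hji (by rw [h]), fun x => slope x.1,
      slope_mem_directions (Ne.symm hne), slope_mem_directions hja, ?_⟩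
    rw [linearIndepOn_pair_iff _ (fun h => hji (by rw [h])) (by simp [slope])]
    intro c hc
    simp only [slope, Prod.smul_mk, smul_eq_mul, mul_one, Prod.mk.injEq] at hc
    obtain ⟨rfl, h2⟩ := hc
    rw [one_mul] at h2
    exact hji (Fin.ext (by exact_mod_cast h2.symm))
  · push Not at hex
    have h2 : 1 < (J \ lindstromPart r a.1).ncard := by
      have h3 := ncard_le_ncard_sdiff_add_ncard J (lindstromPart r a.1) (toFinite _)
      rw [ncard_lindstromPart] at h3
      omega
    obtain ⟨i, ⟨hi, hia⟩, j, ⟨hj, hja⟩, hij⟩ := (one_lt_ncard (toFinite _)).1 h2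
    have htop : ∀ x ∈ J, x ∉ lindstromPart r a.1 → directions a.1 x.1 = ⊤ := by
      intro x hx hxa
      unfold directions
      rw [if_neg (show ¬ x.1 = a.1 from hxa), if_neg (hex x hx)]
    refine ⟨i, hi, j, hj, fun h => hia (by rw [h]; rfl), fun h => hja (by rw [h]; rfl), hij,
      fun x => if x = i then (1, 0) else (0, 1), by rw [htop i hi hia]; trivial,
      by rw [htop j hj hja]; trivial, ?_⟩
    rw [linearIndepOn_pair_iff _ hij (by simp)]
    intro c hc
    simp [hij.symm] at hc

/-- Contracting an element of `M(r)` gives a representable matroid: generic vectors with the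
directions prescribed by the part of the contracted element represent it. -/
theorem exists_linearIndepOn_iff_lindstrom_insert (hr : 4 ≤ r) (a : Fin 4 × Fin (r - 2)) :
    ∃ v : Fin 4 × Fin (r - 2) → (ℚ × ℚ) × (Fin (r - 3) → ℚ), ∀ I, a ∉ I →
      ((lindstrom r).Indep (insert a I) ↔ LinearIndepOn ℚ v I) := by
  classical
  obtain ⟨v, hvU, hv⟩ := exists_generic
    (fun x : Fin 4 × Fin (r - 2) => (directions a.1 x.1).prod (⊤ : Submodule ℚ (Fin (r - 3) → ℚ)))
  refine ⟨v, fun I haI => ⟨fun hI => ?_, fun hI => ?_⟩⟩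
  · obtain ⟨J, hJ, hIJ⟩ := hI.exists_isBase_superset
    have haJ : a ∈ J := hIJ (mem_insert _ _)
    have hJr := ncard_of_isBase_lindstrom hr hJ
    obtain ⟨i, hi, j, hj, hia, hja, hij, y, hyi, hyj, hy⟩ := exists_independent_directions hr hJ a
    let K := J \ {a, i, j}
    have hK : K.ncard = r - 3 := by
      have h1 : ({a, i, j} : Set (Fin 4 × Fin (r - 2))).ncard = 3 := by
        rw [ncard_insert_of_notMem (by simp [hia.symm, hja.symm]) (toFinite _), ncard_pair hij]
      have h2 := ncard_sdiff_add_ncard_of_subset (s := {a, i, j}) (t := J)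
        (insert_subset haJ (pair_subset hi hj)) (toFinite _)
      change (J \ {a, i, j}).ncard = _
      omega
    obtain ⟨w, hw⟩ := exists_linearIndepOn_iff_ncard_le (Fin 4 × Fin (r - 2)) (r - 3)
    have hwK := (hw K).2 hK.le
    let u : Fin 4 × Fin (r - 2) → (ℚ × ℚ) × (Fin (r - 3) → ℚ) :=
      fun x => if x = i ∨ x = j then (y x, 0) else (0, w x)
    have hu1 : LinearIndepOn ℚ u {i, j} := by
      refine (hy.map_injOn (LinearMap.inl ℚ (ℚ × ℚ) (Fin (r - 3) → ℚ))
        LinearMap.inl_injective.injOn).congr fun x hx => ?_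
      exact (if_pos hx).symm
    have hu2 : LinearIndepOn ℚ u K := by
      refine (hwK.map_injOn (LinearMap.inr ℚ (ℚ × ℚ) (Fin (r - 3) → ℚ))
        LinearMap.inr_injective.injOn).congr fun x hx => ?_
      exact (if_neg fun h => hx.2 (Or.inr h)).symm
    have hu : LinearIndepOn ℚ u ({i, j} ∪ K) := by
      refine hu1.union hu2 ?_
      refine (LinearMap.disjoint_inl_inr (R := ℚ) (M := ℚ × ℚ) (M₂ := Fin (r - 3) → ℚ)).mono ?_ ?_
      · rw [Submodule.span_le]
        rintro _ ⟨x, hx, rfl⟩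
        exact ⟨y x, (if_pos hx).symm⟩
      · rw [Submodule.span_le]
        rintro _ ⟨x, hx, rfl⟩
        exact ⟨w x, (if_neg fun h => hx.2 (Or.inr h)).symm⟩
    refine hv I ⟨u, fun x _ => ?_, hu.mono fun x hx => ?_⟩
    · by_cases hxi : x = i
      · subst hxi
        simpa [u] using hyi
      by_cases hxj : x = j
      · subst hxj
        simpa [u] using hyj
      simp [u, hxi, hxj]
    · by_cases hxij : x = i ∨ x = j
      · exact Or.inl hxij
      · refine Or.inr ⟨hIJ (mem_insert_of_mem _ hx), fun h => ?_⟩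
        rcases h with rfl | h
        exacts [haI hx, hxij h]
  · have hcard : I.ncard ≤ r - 1 := by
      have h1 := hI.encard_le_toENat_rank
      simp only [rank_prod', rank_fun', Fintype.card_fin, CommSemiring.rank_self, map_add,
        map_natCast, map_one] at h1
      rw [← (toFinite I).cast_ncard_eq] at h1
      have h2 : I.ncard ≤ 1 + 1 + (r - 3) := by exact_mod_cast h1
      omega
    have hins : (insert a I).ncard = I.ncard + 1 := ncard_insert_of_notMem haI (toFinite _)
    refine lindstrom_indep_iff.2 ⟨by omega, fun H hH => ?_⟩
    by_cases haH : a ∈ H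
    · obtain ⟨q, hq, rfl⟩ := exists_isPartner_of_mem hH haH
      rw [insert_inter_of_mem haH]
      have hins' : (insert a (I ∩ lindstromBlock r a.1 q)).ncard =
          (I ∩ lindstromBlock r a.1 q).ncard + 1 :=
        ncard_insert_of_notMem (fun h => haI h.1) (toFinite _)
      -- the vectors of the block lie in the sum of a line and the `(r - 3)`-dimensional space
      let P : ((ℚ × ℚ) × (Fin (r - 3) → ℚ)) →ₗ[ℚ] ℚ × (Fin (r - 3) → ℚ) :=
        (LinearMap.fst ℚ ℚ ℚ).prodMap LinearMap.id
      have hspan : Submodule.span ℚ (v '' (I ∩ lindstromBlock r a.1 q)) ≤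
          (Submodule.span ℚ {slope q}).prod ⊤ := by
        rw [Submodule.span_le]
        rintro _ ⟨x, ⟨-, hx⟩, rfl⟩
        refine Submodule.prod_mono ?_ le_rfl (hvU x)
        unfold directions
        rcases hx with hx | hx
        · rw [if_pos hx]
          exact bot_le
        · rw [hx, if_neg hq.1.symm, if_pos hq]
      have hP : InjOn P (Submodule.span ℚ (v '' (I ∩ lindstromBlock r a.1 q))) := by
        refine LinearMap.injOn_of_disjoint_ker (p := (Submodule.span ℚ {slope q}).prod ⊤)
          hspan ?_
        rw [Submodule.disjoint_def]
        rintro ⟨y, w⟩ ⟨hy, -⟩ hker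
        obtain ⟨c, rfl⟩ := Submodule.mem_span_singleton.1 hy
        have h1 : P (c • slope q, w) = 0 := hker
        simp only [P, slope, LinearMap.prodMap_apply, LinearMap.fst_apply, LinearMap.id_apply,
          Prod.smul_mk, smul_eq_mul, mul_one, Prod.mk_eq_zero] at h1
        obtain ⟨rfl, rfl⟩ := h1
        simp
      have h1 := ((hI.mono inter_subset_left).map_injOn P hP).encard_le_toENat_rank
      simp only [rank_prod', rank_fun', Fintype.card_fin, CommSemiring.rank_self, map_add,
        map_natCast, map_one] at h1
      rw [← (toFinite _).cast_ncard_eq] at h1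
      have h2 : (I ∩ lindstromBlock r a.1 q).ncard ≤ 1 + (r - 3) := by exact_mod_cast h1
      omega
    · rw [insert_inter_of_notMem haH]
      exact (ncard_le_ncard inter_subset_left (toFinite _)).trans hcard

theorem isRepresentable_lindstromSum_contract (hr : 4 ≤ r) (a : Fin 4 × Fin (r - 2)) :
    (lindstromSum r ／ {Sum.inl a}).IsRepresentable := by
  obtain ⟨v, hv⟩ := exists_linearIndepOn_iff_lindstrom_insert hr a
  obtain ⟨w, hw⟩ := exists_linearIndepOn_iff_ncard_le (Fin 3) 2
  refine ⟨_, inferInstance, inferInstance, Sum.elim (LinearMap.inl ℚ _ _ ∘ v)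
    (LinearMap.inr ℚ _ _ ∘ w), fun I hI => ?_⟩
  have haI : Sum.inl a ∉ I := fun h => (hI h).2 rfl
  have hl : Sum.inl ⁻¹' (I ∪ {Sum.inl a}) = insert a (Sum.inl ⁻¹' I) := by
    ext x
    simp
  have hr' : Sum.inr ⁻¹' (I ∪ {Sum.inl a}) = Sum.inr ⁻¹' I := by
    ext x
    simp
  have ha : (lindstromSum r).Indep {Sum.inl a} := by
    rw [lindstromSum_indep_iff, uniform_indep_iff]
    constructor
    · refine lindstrom_indep_of_ncard_lt ((ncard_le_ncard (t := {a}) ?_ (toFinite _)).trans_lt ?_)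
      · intro x hx
        simpa using hx
      · rw [ncard_singleton]; omega
    · have : Sum.inr ⁻¹' {Sum.inl a} = (∅ : Set (Fin 3)) := by
        ext x
        simp
      simp [this]
  rw [ha.contract_indep_iff, and_iff_right (disjoint_singleton_right.2 haI),
    lindstromSum_indep_iff, hl, hr', uniform_indep_iff, linearIndepOn_sumElim_iff, hw, hv _ haI]

/-- A restriction of `M(r)` without dependent `r`-sets is uniform, hence representable together with
`U_{2,3}`. -/
theorem isRepresentable_lindstromSum_restrict {X : Set (Fin 4 × Fin (r - 2))}
    (hX : ∀ Z ⊆ X, Z.ncard ≤ r → (lindstrom r).Indep Z) :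
    (lindstromSum r ↾ (Sum.inl '' X ∪ range Sum.inr)).IsRepresentable := by
  obtain ⟨v, hv⟩ := exists_linearIndepOn_iff_ncard_le (Fin 4 × Fin (r - 2)) r
  obtain ⟨w, hw⟩ := exists_linearIndepOn_iff_ncard_le (Fin 3) 2
  refine ⟨_, inferInstance, inferInstance, Sum.elim (LinearMap.inl ℚ _ _ ∘ v)
    (LinearMap.inr ℚ _ _ ∘ w), fun I hI => ?_⟩
  rw [restrict_indep_iff, and_iff_left (show I ⊆ Sum.inl '' X ∪ range Sum.inr from hI),
    lindstromSum_indep_iff, uniform_indep_iff,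
    linearIndepOn_sumElim_iff, hw, hv]
  refine and_congr_left fun _ => ⟨fun h => (lindstrom_indep_iff.1 h).1, hX _ fun x hx => ?_⟩
  rcases hI hx with ⟨y, hy, hyx⟩ | ⟨y, hyx⟩
  · exact Sum.inl_injective hyx ▸ hy
  · exact absurd hyx (by simp)

/-- A minor of `M(r) ⊕ U_{2,3}` that is not representable arises without contracting an element
of `M(r)`, and what remains of `M(r)` is not uniform. So `r` can be read off from the sizes of the
circuits of the minor. -/
theorem exists_isCircuit_of_isMinor_lindstromSum (hr : 4 ≤ r)
    {N : Matroid ((Fin 4 × Fin (r - 2)) ⊕ Fin 3)} (hN : N ≤m lindstromSum r)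
    (hrep : ¬ N.IsRepresentable) :
    (∃ Z, N.IsCircuit Z ∧ Z.encard = r) ∧
      ∀ Z, N.IsCircuit Z → Z.encard ≤ 3 ∨ (r : ℕ∞) ≤ Z.encard := by
  obtain ⟨C, D, hCE, -, hCD, rfl⟩ := hN.exists_eq_contract_delete_disjoint
  have hCl : ∀ a, Sum.inl a ∉ C := by
    intro a ha
    refine hrep ((isRepresentable_lindstromSum_contract hr a).of_isMinor ⟨C, D, ?_⟩)
    rw [contract_contract, union_eq_self_of_subset_left (singleton_subset_iff.2 ha)]
  obtain ⟨I₀, hI₀⟩ := (lindstromSum r).exists_isBasis C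
  obtain ⟨Q, hQ, hQ0⟩ : ∃ Q : Set (Fin 3) → Prop,
      (∀ K ⊆ (lindstromSum r ／ C ＼ D).E, ((lindstromSum r ／ C ＼ D).Indep K ↔
        (lindstrom r).Indep (Sum.inl ⁻¹' K) ∧ Q (Sum.inr ⁻¹' K))) ∧ Q ∅ := by
    refine ⟨fun S => (uniform 2 3).Indep (S ∪ Sum.inr ⁻¹' I₀), fun K hK => ?_, ?_⟩
    · have hKD : Disjoint K D := disjoint_left.2 fun e he heD => (hK he).2 heD
      have hKC : Disjoint C K := disjoint_left.2 fun e heC he => (hK he).1.2 heC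
      have hl : Sum.inl ⁻¹' (K ∪ I₀) = Sum.inl ⁻¹' K := by
        ext x
        exact or_iff_left fun h => hCl x (hI₀.subset h)
      rw [delete_indep_iff, and_iff_left hKD, hI₀.contract_indep_iff, and_iff_left hKC,
        lindstromSum_indep_iff, hl, preimage_union]
    · change (uniform 2 3).Indep (∅ ∪ Sum.inr ⁻¹' I₀)
      rw [empty_union]
      exact (lindstromSum_indep_iff.1 hI₀.indep).2
  have hinr : ∀ Z : Set (Fin 4 × Fin (r - 2)), Sum.inr ⁻¹' (Sum.inl '' Z) = (∅ : Set (Fin 3)) :=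
    fun Z => by ext; simp
  constructor
  · obtain ⟨Z, hZX, hZr, hZ⟩ : ∃ Z ⊆ Sum.inl ⁻¹' (lindstromSum r ／ C ＼ D).E,
        Z.ncard ≤ r ∧ ¬ (lindstrom r).Indep Z := by
      by_contra! hcon
      refine hrep ((isRepresentable_lindstromSum_restrict hcon).of_isMinor ?_)
      set Y : Set ((Fin 4 × Fin (r - 2)) ⊕ Fin 3) :=
        Sum.inl '' (Sum.inl ⁻¹' (lindstromSum r ／ C ＼ D).E) ∪ range Sum.inr with hY
      have hCY : C ⊆ Y := by
        rintro (a | b) h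
        · exact absurd h (hCl a)
        · exact Or.inr ⟨b, rfl⟩
      have hEY : (lindstromSum r ／ C ＼ D).E ⊆ Y := by
        rintro (a | b) h
        · exact Or.inl ⟨a, h, rfl⟩
        · exact Or.inr ⟨b, rfl⟩
      refine ⟨C, D, ?_⟩
      rw [restrict_contract_eq_contract_restrict _ hCY, delete_eq_restrict, delete_eq_restrict,
        restrict_ground_eq, restrict_restrict_eq _ sdiff_subset]
      congr 1
      ext e
      constructor
      · exact fun he => ⟨⟨hEY he, he.1.2⟩, he.2⟩
      · exact fun he => ⟨⟨by simp, he.1.2⟩, he.2⟩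
    have hZr' : Z.ncard = r := by
      by_contra hne
      exact hZ (lindstrom_indep_of_ncard_lt (by omega))
    have hZE : Sum.inl '' Z ⊆ (lindstromSum r ／ C ＼ D).E := by
      rintro _ ⟨x, hx, rfl⟩
      exact hZX hx
    refine ⟨Sum.inl '' Z, isCircuit_iff_forall_ssubset.2 ⟨⟨fun h => ?_, hZE⟩, fun K hK => ?_⟩, ?_⟩
    · rw [hQ _ hZE, preimage_image_eq _ Sum.inl_injective] at h
      exact hZ h.1
    · obtain ⟨K, hKZ, rfl⟩ := subset_image_iff.1 hK.subset
      rw [hQ _ (hK.subset.trans hZE), preimage_image_eq _ Sum.inl_injective, hinr]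
      refine ⟨lindstrom_indep_of_ncard_lt ?_, hQ0⟩
      exact (ncard_lt_ncard ⟨hKZ, fun h => hK.2 (image_mono h)⟩ (toFinite _)).trans_eq hZr'
    · rw [Sum.inl_injective.encard_image, ← (toFinite Z).cast_ncard_eq, hZr']
  · intro Z hZ
    have hZi := hZ.not_indep
    rw [hQ Z hZ.subset_ground, not_and_or] at hZi
    rcases hZi with h | h
    · right
      have hsub : Sum.inl '' (Sum.inl ⁻¹' Z) ⊆ Z := image_preimage_subset _ _
      have heq := hZ.eq_of_not_indep_subset (fun hi => h ?_) hsub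
      · rw [← heq, Sum.inl_injective.encard_image, ← (toFinite _).cast_ncard_eq]
        by_contra! hlt
        exact h (lindstrom_indep_of_ncard_lt (by exact_mod_cast hlt))
      · rw [hQ _ (hsub.trans hZ.subset_ground), preimage_image_eq _ Sum.inl_injective] at hi
        exact hi.1
    · left
      have hsub : Sum.inr '' (Sum.inr ⁻¹' Z) ⊆ Z := image_preimage_subset _ _
      have heq := hZ.eq_of_not_indep_subset (fun hi => h ?_) hsub
      · rw [← heq, Sum.inr_injective.encard_image]
        refine (encard_le_encard (subset_univ _)).trans ?_
        simp
      · rw [hQ _ (hsub.trans hZ.subset_ground), preimage_image_eq _ Sum.inr_injective] at hi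
        exact hi.2

end LindstromMinors

/-! ### Forbidden minors -/

section Forbidden

variable {α β : Type*} {M : Matroid α} {N : Matroid β} {d k : ℕ}

theorem IsIsomorphic.symm (h : M.IsIsomorphic N) : N.IsIsomorphic M := by
  obtain ⟨f, hf⟩ := h
  refine ⟨f.symm, fun I => ?_⟩
  rw [hf, f.image_symm_image]

theorem IsIsomorphic.exists_isCircuit (h : M.IsIsomorphic N) {Z : Set α} (hZ : M.IsCircuit Z) :
    ∃ Z', N.IsCircuit Z' ∧ Z'.encard = Z.encard := by
  obtain ⟨f, hf⟩ := h
  obtain ⟨Z, rfl⟩ : ∃ Z₀ : Set M.E, Z = Subtype.val '' Z₀ :=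
    ⟨Subtype.val ⁻¹' Z, by rw [Subtype.image_preimage_coe, inter_eq_right.2 hZ.subset_ground]⟩
  refine ⟨Subtype.val '' (f '' Z), isCircuit_iff_forall_ssubset.2
    ⟨⟨fun h => hZ.not_indep ((hf Z).2 h), ?_⟩, fun K hK => ?_⟩, ?_⟩
  · rintro _ ⟨e, -, rfl⟩
    exact e.2
  · obtain ⟨K, hKZ, rfl⟩ := subset_image_iff.1 hK.subset
    obtain ⟨K, hKZ', rfl⟩ := subset_image_iff.1 hKZ
    rw [← hf]
    exact hZ.ssubset_indep ⟨image_mono hKZ', fun h => hK.2 (image_mono (image_mono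
      ((image_subset_image_iff Subtype.val_injective).1 h)))⟩
  · rw [Subtype.val_injective.encard_image, f.injective.encard_image,
      Subtype.val_injective.encard_image]

/-- Lower powers exist: the degrees up to `k` of a graded power form a graded power. -/
theorem HasSymmetricPower.of_le (h : M.HasSymmetricPower d) (hk : 1 ≤ k) (hkd : k ≤ d) :
    M.HasSymmetricPower k := by
  by_cases hM : M.eRank = 0
  · exact hasSymmetricPower_of_eRank_eq_zero hk hM
  obtain ⟨c, hc⟩ : ∃ c, M.IsNonloop c := by
    by_contra! hcon
    refine hM ?_
    rw [← eRk_ground, eRk_eq_zero_iff]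
    exact fun e he => (not_isNonloop_iff he).1 (hcon e)
  obtain ⟨V, hV, hind⟩ := h.exists_isGradedPower (hk.trans hkd) hc
  have : M.RankFinite := by
    obtain ⟨-, -, r, hr, -⟩ := h
    rw [← eRank_ne_top_iff, hr]
    exact ENat.natCast_ne_top r
  obtain ⟨B, hB⟩ := M.exists_isBase
  have hV' : M.IsGradedPower k V :=
    ⟨fun i hi => hV.ground i (hi.trans hkd), fun h => hV.one (h.trans hkd),
      fun i hi => hV.mul i (hi.trans_le hkd), fun i hi => hV.loop i (hi.trans hkd)⟩
  exact hV'.hasSymmetricPower hk hB hB.finite (hind k hkd B hB)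

theorem exists_isForbiddenMinor (hM : M.Finite) (h : ¬ M.HasSymmetricPower d) :
    ∃ N, N ≤m M ∧ N.IsForbiddenMinor d := by
  obtain ⟨N, ⟨hNM, hN⟩, hmin⟩ := (measure fun N : Matroid α => N.E.ncard).wf.has_min
    {N | N ≤m M ∧ ¬ N.HasSymmetricPower d} ⟨M, IsMinor.refl, h⟩
  have hfin : N.E.Finite := hM.ground_finite.subset hNM.subset
  refine ⟨N, hNM, ⟨hfin⟩, hN, fun N' hN' => ?_⟩
  by_contra hcon
  exact hmin N' ⟨hN'.isMinor.trans hNM, hcon⟩ (ncard_lt_ncard hN'.ssubset hfin)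

theorem exists_isForbiddenMinor_lindstromSum {r : ℕ} (hd : 2 ≤ d) (hr : 4 ≤ r) :
    ∃ N : Matroid ((Fin 4 × Fin (r - 2)) ⊕ Fin 3), N ≤m lindstromSum r ∧ N.IsForbiddenMinor d ∧
      ∀ s : ℕ, 4 ≤ s → s ≠ r →
        ∀ N' : Matroid ((Fin 4 × Fin (s - 2)) ⊕ Fin 3), N' ≤m lindstromSum s →
        ¬ N.IsIsomorphic N' := by
  obtain ⟨N, hNM, hN⟩ := exists_isForbiddenMinor (M := lindstromSum r) (d := d) inferInstance
    fun h => not_hasSymmetricPower_two_lindstromSum hr (h.of_le (by omega) hd)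
  refine ⟨N, hNM, hN, fun s hs hsr N' hN' hiso => hsr ?_⟩
  have hrep : ¬ N.IsRepresentable := fun h => hN.2.1 (h.hasSymmetricPower hN.1 (by omega))
  have hrep' : ¬ N'.IsRepresentable := fun h => hrep (h.of_isIsomorphic hiso)
  obtain ⟨⟨Z, hZ, hZr⟩, hc⟩ := exists_isCircuit_of_isMinor_lindstromSum hr hNM hrep
  obtain ⟨⟨Z', hZ', hZs⟩, hc'⟩ := exists_isCircuit_of_isMinor_lindstromSum hs hN' hrep'
  obtain ⟨Y, hY, hYr⟩ := hiso.exists_isCircuit hZ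
  obtain ⟨Y', hY', hYs⟩ := hiso.symm.exists_isCircuit hZ'
  -- `N'` has an `r`-circuit and `N` an `s`-circuit, so that `s ≤ r` and `r ≤ s`
  have h1 := hc Y' hY'
  have h2 := hc' Y hY
  rw [hYs, hZs] at h1
  rw [hYr, hZr] at h2
  norm_cast at h1 h2
  omega

end Forbidden

end Matroid

theorem mainTheorem2 :
    (∀ d : ℕ, 1 ≤ d → ∀ (α : Type*) (M N : Matroid α), M.Finite → N.IsMinor M →
      M.HasSymmetricPower d → N.HasSymmetricPower d) ∧
    (∀ d : ℕ, 2 ≤ d → ∃ (α : ℕ → Type) (N : ∀ k, Matroid (α k)),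
      (∀ k, (N k).IsForbiddenMinor d) ∧
      ∀ j k, j ≠ k → ¬ (N j).IsIsomorphic (N k)) ∧
    (∀ r : ℕ, 4 ≤ r → ¬ (Matroid.lindstromSum r).HasSymmetricPower 2) ∧
    (∀ d : ℕ, 2 ≤ d → ∀ r : ℕ, 4 ≤ r →
      ∃ N : Matroid ((Fin 4 × Fin (r - 2)) ⊕ Fin 3), N.IsMinor (Matroid.lindstromSum r) ∧
      N.IsForbiddenMinor d ∧
      ∀ s : ℕ, 4 ≤ s → s ≠ r →
        ∀ N' : Matroid ((Fin 4 × Fin (s - 2)) ⊕ Fin 3), N'.IsMinor (Matroid.lindstromSum s) →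
        ¬ N.IsIsomorphic N') := by
  refine ⟨fun d hd α M N _ hNM hM => hM.of_isMinor hd hNM, fun d hd => ?_,
    fun r hr => Matroid.not_hasSymmetricPower_two_lindstromSum hr,
    fun d hd r hr => Matroid.exists_isForbiddenMinor_lindstromSum hd hr⟩
  choose N hNM hN hiso using fun k : ℕ =>
    Matroid.exists_isForbiddenMinor_lindstromSum (r := k + 4) hd (by omega)
  exact ⟨fun k => (Fin 4 × Fin (k + 4 - 2)) ⊕ Fin 3, N, hN, fun j k hjk =>
    hiso j (k + 4) (by omega) (by omega) (N k) (hNM k)⟩
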